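/- For a finite abelian group $\Gamma$ and $X\subseteq\Gamma$ let $X\hat{+}X=\{x+y : x,y\in X,\ x\neq y\}$ be the restricted sumset, and let $S_k^m(\Gamma)$ be the collection of all $X\subseteq\Gamma$ with $|X|=k$ and $|X\hat{+}X|=m$. Write $\mathbb{Z}_N=\mathbb{Z}/N\mathbb{Z}$. (i) There is an absolute constant $k_0\ge 1$ such that for all integers $k\ge k_0$, all integers $N\ge 1$ and all integers $m\ge 0$ with $m\le \tfrac12 k^{31/30}$, $$|S_k^m(\mathbb{Z}_N)|\;\le\; N^{1+\frac{4m}{k}}\left(\frac{2em}{k}\right)^k\exp\left(k^{31/32}\right).$$ (ii) For all integers $k\ge 1$, $N\ge 1$ and $m\ge 0$, $$|S_k^m(\mathbb{Z}_N)|\;\le\; N^{1+\frac{4m}{k}}\,k^{4k}.$$ -/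

import Mathlib

/-- The restricted sumset of `X` with itself: the set of all sums `i + j` with
`i, j ∈ X` and `i ≠ j`. -/
def restrictedSumset {Γ : Type*} [AddCommGroup Γ] [DecidableEq Γ] (X : Finset Γ) : Finset Γ :=
  X.offDiag.image (fun p => p.1 + p.2)

/-- The collection of all `X ⊆ Γ` with `k` elements whose restricted sumset has exactly
`m` elements. -/
def restrictedFamily (Γ : Type*) [AddCommGroup Γ] [Fintype Γ] [DecidableEq Γ] (k m : ℕ) :
    Finset (Finset Γ) :=
  Finset.univ.filter (fun X => X.card = k ∧ (restrictedSumset X).card = m)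

/-! Sets with few restricted sums satisfy many linear relations, and relations modulo `N` cost
freedom. If `φ` maps `X` to `ℝ` and respects all coincidences `a + b = c + d` between pairs of
distinct elements, the rank `r` of its differences satisfies `r * |X| ≤ 2m`
(`finrank_differenceSpan_mul_card_le`). Write the elements of `X` as integer combinations of a tuple
`γ` of `g` elements of `X`, and apply this to the coordinate vectors modulo the span of the
relations that hold at `γ`: that span has rank at least `g - ρ`, where `ρ = 1 + ⌊2m/k⌋`
(`le_finrank_relations`). A system of `n` independent integer forms has at most `L ^ n * N ^ (g -
n)` zeros modulo `N`, by a determinant bound (`card_solutions_le`). So each choice of relations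
leaves about `N ^ ρ` tuples.

For (ii), `γ` enumerates all of `X`, and the choices of relations cost at most `k ^ (4k)`.

For (i), a much shorter `γ` is used. By Plünnecke's inequality `j • X` is small, so a maximal
dissociated subset of `X` has at most `g` elements, and `X` has coordinates in `{-1, 0, 1}` over it
(`exists_coordinates`). A greedy hitting-set argument then covers `X` by a set of the form
(restricted sums of `A` and `B`) `- x₀`, together with `E`, where `A`, `B`, `E` are small subsets of
`X` (`exists_sparse_cover`). The coordinates of `A`, `B`, `E`, `x₀` and the tuple `γ` encode this
container, which has at most `2m` elements; choosing `X` inside it gives the main term `(2em/k)^k`.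
-/

/-! ### A Freiman-type rank inequality for restricted sumsets -/

/-- The `ℚ`-span of all differences of values of `φ` on `X`. -/
noncomputable def differenceSpan {Γ : Type*} (φ : Γ → ℝ) (X : Finset Γ) : Submodule ℚ ℝ :=
  Submodule.span ℚ (Set.image2 (fun a b => φ a - φ b) X X)

instance {Γ : Type*} (φ : Γ → ℝ) (X : Finset Γ) : FiniteDimensional ℚ (differenceSpan φ X) :=
  FiniteDimensional.span_of_finite ℚ (Set.Finite.image2 _ X.finite_toSet X.finite_toSet)

theorem mem_restrictedSumset {Γ : Type*} [AddCommGroup Γ] [DecidableEq Γ] {X : Finset Γ} {s : Γ} :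
    s ∈ restrictedSumset X ↔ ∃ a ∈ X, ∃ b ∈ X, a ≠ b ∧ a + b = s := by
  simp only [restrictedSumset, Finset.mem_image, Finset.mem_offDiag, Prod.exists]
  constructor
  · rintro ⟨a, b, ⟨ha, hb, h⟩, rfl⟩
    exact ⟨a, ha, b, hb, h, rfl⟩
  · rintro ⟨a, ha, b, hb, h, rfl⟩
    exact ⟨a, b, ⟨ha, hb, h⟩, rfl⟩

/-- Every element of a finite set of positive reals is a sum of indecomposable elements. -/
theorem span_indecomposable (D : Finset ℝ) (hD : ∀ d ∈ D, 0 < d) :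
    (D : Set ℝ) ⊆ Submodule.span ℚ
      ((D.filter fun d => ¬ ∃ x ∈ D, ∃ y ∈ D, d = x + y : Finset ℝ) : Set ℝ) := by
  classical
  by_contra hcon
  obtain ⟨d, hd, hmin⟩ := (D.filter fun d => d ∉ Submodule.span ℚ
      ((D.filter fun d => ¬ ∃ x ∈ D, ∃ y ∈ D, d = x + y : Finset ℝ) : Set ℝ)).exists_min_image id (by
    obtain ⟨d, hd, hd'⟩ := Set.not_subset.1 hcon
    exact ⟨d, Finset.mem_filter.2 ⟨hd, hd'⟩⟩)
  rw [Finset.mem_filter] at hd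
  have hmem : ∀ x ∈ D, x < d → x ∈ Submodule.span ℚ
      ((D.filter fun d => ¬ ∃ x ∈ D, ∃ y ∈ D, d = x + y : Finset ℝ) : Set ℝ) := by
    intro x hx hxd
    by_contra h
    exact absurd (hmin x (Finset.mem_filter.2 ⟨hx, h⟩)) (not_le.2 hxd)
  -- A minimal counterexample that decomposes has two smaller positive summands, both already in the
  -- span.
  apply hd.2
  by_cases h : ∃ x ∈ D, ∃ y ∈ D, d = x + y
  · obtain ⟨x, hx, y, hy, rfl⟩ := h
    exact Submodule.add_mem _ (hmem x hx (by linarith [hD y hy])) (hmem y hy (by linarith [hD x hx]))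
  · exact Submodule.subset_span (by simpa using ⟨hd.1, by simpa using h⟩)

section
variable {Γ : Type*} [AddCommGroup Γ] [DecidableEq Γ]

/-- New restricted sums created by adding to `A` a set `F` on which `φ` is constant and smaller. -/
theorem card_restrictedSumset_add_le (φ : Γ → ℝ) (F A : Finset Γ) (v : ℝ) (I : Finset ℝ)
    (hφ : ∀ a ∈ F ∪ A, ∀ b ∈ F ∪ A, ∀ c ∈ F ∪ A, ∀ d ∈ F ∪ A, a ≠ b → c ≠ d → a + b = c + d →
      φ a + φ b = φ c + φ d)
    (hF : ∀ a ∈ F, φ a = v) (hI : ∀ d ∈ I, 0 < d ∧ ∃ a ∈ A, φ a - v = d)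
    (hnew : ∀ d ∈ I, ∀ x ∈ A, ∀ y ∈ A, d ≠ (φ x - v) + (φ y - v)) :
    (restrictedSumset A).card + F.card * I.card ≤ (restrictedSumset (F ∪ A)).card := by
  choose! s hsA hs using fun d hd => (hI d hd).2
  have hne : ∀ f ∈ F, ∀ d ∈ I, f ≠ s d := by
    rintro f hf d hd rfl
    have := hs d hd
    rw [hF _ hf] at this
    have := (hI d hd).1
    linarith
  have hF' : ∀ f ∈ F, f ∈ F ∪ A := fun f hf => Finset.mem_union_left _ hf
  have hA' : ∀ f ∈ A, f ∈ F ∪ A := fun f hf => Finset.mem_union_right _ hf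
  have hinj : Set.InjOn (fun p : Γ × ℝ => p.1 + s p.2) ((F ×ˢ I : Finset (Γ × ℝ)) : Set (Γ × ℝ)) := by
    rintro ⟨f, d⟩ h1 ⟨f', d'⟩ h2 h
    simp only [Finset.coe_product, Set.mem_prod, Finset.mem_coe] at h1 h2
    simp only at h
    have := hφ f (hF' _ h1.1) (s d) (hA' _ (hsA d h1.2)) f' (hF' _ h2.1) (s d')
      (hA' _ (hsA d' h2.2)) (hne _ h1.1 _ h1.2) (hne _ h2.1 _ h2.2) h
    -- The value of `φ` on the sum `f + s d` is `2 * v + d`, so it determines `d`.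
    have hd : d = d' := by
      linarith [hF _ h1.1, hF _ h2.1, hs d h1.2, hs d' h2.2]
    subst hd
    simpa using h
  rw [← Finset.card_product, ← Finset.card_image_of_injOn hinj, ← Finset.card_union_of_disjoint]
  · apply Finset.card_le_card
    intro z hz
    rcases Finset.mem_union.1 hz with hz | hz
    · obtain ⟨a, ha, b, hb, h⟩ := mem_restrictedSumset.1 hz
      exact mem_restrictedSumset.2 ⟨a, hA' _ ha, b, hA' _ hb, h⟩
    · obtain ⟨⟨f, d⟩, hp, rfl⟩ := Finset.mem_image.1 hz
      rw [Finset.mem_product] at hp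
      exact mem_restrictedSumset.2 ⟨f, hF' _ hp.1, s d, hA' _ (hsA d hp.2), hne _ hp.1 _ hp.2, rfl⟩
  · rw [Finset.disjoint_left]
    intro z hz hz'
    obtain ⟨⟨f, d⟩, hp, rfl⟩ := Finset.mem_image.1 hz'
    rw [Finset.mem_product] at hp
    obtain ⟨x, hx, y, hy, hxy, h⟩ := mem_restrictedSumset.1 hz
    have := hφ x (hA' _ hx) y (hA' _ hy) f (hF' _ hp.1) (s d) (hA' _ (hsA d hp.2)) hxy
      (hne _ hp.1 _ hp.2) h
    refine hnew d hp.2 x hx y hy ?_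
    linarith [hF _ hp.1, hs d hp.2]

/-- A rank version of Freiman's lemma for restricted sumsets, allowing `φ` to be non-injective. -/
theorem finrank_differenceSpan_mul_card_le (φ : Γ → ℝ) (X : Finset Γ)
    (hφ : ∀ a ∈ X, ∀ b ∈ X, ∀ c ∈ X, ∀ d ∈ X, a ≠ b → c ≠ d → a + b = c + d →
      φ a + φ b = φ c + φ d) :
    Module.finrank ℚ (differenceSpan φ X) * X.card ≤ 2 * (restrictedSumset X).card := by
  induction X using Finset.strongInduction with
  | H X ih =>
  rcases X.eq_empty_or_nonempty with rfl | hX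
  · simp
  -- Peel off the whole fibre `F` over the minimum of `φ` and induct on the rest `A`.
  obtain ⟨x₀, hx₀, hmin⟩ := X.exists_min_image φ hX
  set v := φ x₀ with hv
  set F := X.filter fun a => φ a = v with hFdef
  set A := X.filter fun a => ¬ φ a = v with hAdef
  have hXU : F ∪ A = X := Finset.filter_union_filter_not_eq _ _
  have hdisj : Disjoint F A := Finset.disjoint_filter_filter_not _ _ _
  have hcard : F.card + A.card = X.card := by rw [← Finset.card_union_of_disjoint hdisj, hXU]
  have hFv : ∀ a ∈ F, φ a = v := fun a ha => (Finset.mem_filter.1 ha).2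
  have hAX : A ⊆ X := Finset.filter_subset _ _
  have hAv : ∀ a ∈ A, v < φ a := fun a ha =>
    lt_of_le_of_ne (hmin a (hAX ha)) (Ne.symm (Finset.mem_filter.1 ha).2)
  have hFpos : x₀ ∈ F := Finset.mem_filter.2 ⟨hx₀, rfl⟩
  have hss : A ⊂ X := (Finset.ssubset_iff_of_subset hAX).2
    ⟨x₀, hx₀, fun h => (Finset.mem_filter.1 h).2 rfl⟩
  have hIH := ih A hss (fun a ha b hb c hc d hd =>
    hφ a (hAX ha) b (hAX hb) c (hAX hc) d (hAX hd))
  set D : Finset ℝ := A.image fun a => φ a - v with hD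
  have hDpos : ∀ d ∈ D, 0 < d := by
    intro d hd
    obtain ⟨a, ha, rfl⟩ := Finset.mem_image.1 hd
    linarith [hAv a ha]
  have hDmem : ∀ a ∈ A, φ a - v ∈ Submodule.span ℚ (D : Set ℝ) := fun a ha =>
    Submodule.subset_span (Finset.mem_coe.2 (Finset.mem_image_of_mem _ ha))
  have hXD : differenceSpan φ X ≤ Submodule.span ℚ (D : Set ℝ) := by
    have hz : ∀ a ∈ X, φ a - v ∈ Submodule.span ℚ (D : Set ℝ) := by
      intro a ha
      by_cases h : φ a = v
      · rw [h, sub_self]; exact Submodule.zero_mem _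
      · exact hDmem a (Finset.mem_filter.2 ⟨ha, h⟩)
    refine Submodule.span_le.2 ?_
    rintro _ ⟨a, ha, b, hb, rfl⟩
    have := Submodule.sub_mem _ (hz a ha) (hz b hb)
    simpa using this
  set I : Finset ℝ := D.filter fun d => ¬ ∃ x ∈ D, ∃ y ∈ D, d = x + y with hIdef
  have hIspan : Submodule.span ℚ (D : Set ℝ) ≤ Submodule.span ℚ (I : Set ℝ) :=
    Submodule.span_le.2 (span_indecomposable D hDpos)
  have hrI : Module.finrank ℚ (differenceSpan φ X) ≤ I.card :=
    (Submodule.finrank_mono (hXD.trans hIspan)).trans (finrank_span_finset_le_card I)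
  have hID : I.card ≤ D.card := Finset.card_filter_le _ _
  have hφ' : ∀ a ∈ F ∪ A, ∀ b ∈ F ∪ A, ∀ c ∈ F ∪ A, ∀ d ∈ F ∪ A, a ≠ b → c ≠ d →
      a + b = c + d → φ a + φ b = φ c + φ d := by rw [hXU]; exact hφ
  -- If removing `F` does not lower the rank, the `F.card * I.card` new sums suffice, since `I`
  -- spans the differences.
  by_cases hr : Module.finrank ℚ (differenceSpan φ X) ≤ Module.finrank ℚ (differenceSpan φ A)
  · have h := card_restrictedSumset_add_le φ F A v I hφ' hFv (by
      intro d hd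
      have hd' := (Finset.mem_filter.1 hd).1
      obtain ⟨a, ha, hda⟩ := Finset.mem_image.1 hd'
      exact ⟨hDpos d hd', a, ha, hda⟩) (by
      intro d hd x hx y hy h
      exact (Finset.mem_filter.1 hd).2 ⟨_, Finset.mem_image_of_mem _ hx, _,
        Finset.mem_image_of_mem _ hy, h⟩)
    rw [hXU] at h
    rw [← hcard]
    have h1 := Nat.mul_le_mul_left F.card hrI
    have h2 := Nat.mul_le_mul_right A.card hr
    nlinarith
  -- If the rank drops, no element of `D` is a sum of two others: `φ a - v = (φ x - v) + (φ y - v)`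
  -- would recover `v` from values on `A` and put `D` into `differenceSpan φ A`. Hence the number of
  -- new sums is at least `F.card * D.card` and also at least `A.card`. The factor 2 lets both
  -- bounds be added, and the second pays for the rank increase, which is at most 1.
  · push Not at hr
    have hnot : ∀ x ∈ A, ∀ y ∈ A, ∀ a ∈ A, φ a - v ≠ (φ x - v) + (φ y - v) := by
      intro x hx y hy a ha h
      refine absurd (Submodule.finrank_mono (hXD.trans ?_)) (not_le.2 hr)
      refine Submodule.span_le.2 ?_
      intro d hd
      obtain ⟨z, hz, rfl⟩ := Finset.mem_image.1 (Finset.mem_coe.1 hd)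
      have e : φ z - v = (φ z - φ x) + (φ a - φ y) := by linarith
      simp only [e]
      exact Submodule.add_mem _ (Submodule.subset_span ⟨z, hz, x, hx, rfl⟩)
        (Submodule.subset_span ⟨a, ha, y, hy, rfl⟩)
    have h := card_restrictedSumset_add_le φ F A v D hφ' hFv (by
      intro d hd
      obtain ⟨a, ha, hda⟩ := Finset.mem_image.1 hd
      exact ⟨hDpos d hd, a, ha, hda⟩) (by
      intro d hd x hx y hy h
      obtain ⟨a, ha, rfl⟩ := Finset.mem_image.1 hd
      exact hnot x hx y hy a ha h)
    rw [hXU] at h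
    -- translates of `A` by a single element of `F` are new as well
    have h' : (restrictedSumset A).card + A.card ≤ (restrictedSumset X).card := by
      rw [← Finset.card_image_of_injective A (add_right_injective x₀), ← Finset.card_union_of_disjoint]
      · apply Finset.card_le_card
        intro z hz
        rcases Finset.mem_union.1 hz with hz | hz
        · obtain ⟨a, ha, b, hb, h⟩ := mem_restrictedSumset.1 hz
          exact mem_restrictedSumset.2 ⟨a, hAX ha, b, hAX hb, h⟩
        · obtain ⟨a, ha, rfl⟩ := Finset.mem_image.1 hz
          exact mem_restrictedSumset.2 ⟨x₀, hx₀, a, hAX ha, fun h => by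
            have := hAv a ha; rw [← h] at this; exact lt_irrefl _ this, rfl⟩
      · rw [Finset.disjoint_left]
        intro z hz hz'
        obtain ⟨a, ha, rfl⟩ := Finset.mem_image.1 hz'
        obtain ⟨x, hx, y, hy, hxy, h⟩ := mem_restrictedSumset.1 hz
        have := hφ x (hAX hx) y (hAX hy) x₀ hx₀ a (hAX ha) hxy (fun h => by
            have := hAv a ha; rw [← h] at this; exact lt_irrefl _ this) h
        exact hnot x hx y hy a ha (by linarith)
    have hr1 : Module.finrank ℚ (differenceSpan φ X) ≤
        Module.finrank ℚ (differenceSpan φ A) + 1 := by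
      rcases A.eq_empty_or_nonempty with hA | ⟨a₀, ha₀⟩
      · have : I.card ≤ 0 := hID.trans (by rw [hD, hA]; simp)
        omega
      have hle : differenceSpan φ X ≤ differenceSpan φ A ⊔ Submodule.span ℚ {φ a₀ - v} := by
        refine hXD.trans (Submodule.span_le.2 ?_)
        intro d hd
        obtain ⟨z, hz, rfl⟩ := Finset.mem_image.1 (Finset.mem_coe.1 hd)
        have e : φ z - v = (φ z - φ a₀) + (φ a₀ - v) := by ring
        simp only [e]
        exact Submodule.add_mem_sup (Submodule.subset_span ⟨z, hz, a₀, ha₀, rfl⟩)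
          (Submodule.mem_span_singleton_self _)
      refine (Submodule.finrank_mono hle).trans ((Submodule.finrank_add_le_finrank_add_finrank _ _).trans ?_)
      exact Nat.add_le_add_left ((finrank_span_le_card _).trans (by simp)) _
    have hrD := Nat.mul_le_mul_left F.card (hrI.trans hID)
    have hr2 := Nat.mul_le_mul_right A.card hr1
    rw [← hcard]
    nlinarith
end

/-! ### Counting solutions of integer linear systems modulo `N` -/

/-- The product of the row sums expands over all maps `n → n`, and the Leibniz formula uses only the
permutations among them. -/
theorem natAbs_det_le_prod {n : Type*} [Fintype n] [DecidableEq n] (M : Matrix n n ℤ) :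
    M.det.natAbs ≤ ∏ i, ∑ j, (M i j).natAbs := by
  rw [← Matrix.det_transpose, Matrix.det_apply, Finset.prod_univ_sum]
  calc (∑ σ : Equiv.Perm n, Equiv.Perm.sign σ • ∏ i, M.transpose (σ i) i).natAbs
      ≤ ∑ σ : Equiv.Perm n, (Equiv.Perm.sign σ • ∏ i, M.transpose (σ i) i).natAbs :=
        Int.natAbs_sum_le _ _
    _ = ∑ σ : Equiv.Perm n, ∏ i, (M i (σ i)).natAbs := by
        refine Finset.sum_congr rfl fun σ _ => ?_
        rw [Units.smul_def, smul_eq_mul, Int.natAbs_mul, Int.units_natAbs, one_mul,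
          ← Int.natAbsHom_apply, map_prod]
        rfl
    _ = ∑ p ∈ (Finset.univ : Finset (Equiv.Perm n)).image (fun σ : Equiv.Perm n => (⇑σ : n → n)),
          ∏ i, (M i (p i)).natAbs := by
        rw [Finset.sum_image]
        intro σ _ τ _ h
        exact Equiv.coe_fn_injective h
    _ ≤ _ := Finset.sum_le_sum_of_subset (by
        intro p _
        simp)

/-- A nonsingular integer matrix has at most `|det M|` kernel vectors modulo `N`. -/
theorem card_ker_zmod_le {g N : ℕ} [NeZero N] (M : Matrix (Fin g) (Fin g) ℤ) (hM : M.det ≠ 0) :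
    Nat.card (M.map (Int.cast : ℤ → ZMod N)).mulVecLin.toAddMonoidHom.ker ≤ M.det.natAbs := by
  -- For an endomorphism of a finite group the kernel has as many elements as the range has cosets.
  -- The preimage of the range in `ℤ^g` contains `M ℤ^g`, whose index is `|det M|`.
  rw [← AddSubgroup.index_range]
  set H := (M.map (Int.cast : ℤ → ZMod N)).mulVecLin.toAddMonoidHom.range with hH
  let π : (Fin g → ℤ) →+ (Fin g → ZMod N) := (Int.castAddHom (ZMod N)).compLeft (Fin g)
  have hπ : Function.Surjective π := by
    intro y
    choose x hx using fun i => ZMod.intCast_surjective (y i)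
    exact ⟨x, funext hx⟩
  rw [← H.index_comap_of_surjective hπ]
  have hinj : Function.Injective M.mulVecLin := by
    rw [← LinearMap.ker_eq_bot, Submodule.eq_bot_iff]
    intro x hx
    exact Matrix.eq_zero_of_mulVec_eq_zero hM hx
  have hidx : M.mulVecLin.range.toAddSubgroup.index = M.det.natAbs := by
    have := AddSubgroup.index_eq_natAbs_det (Pi.basisFun ℤ (Fin g)) M.mulVecLin.range.toAddSubgroup
      ((Pi.basisFun ℤ (Fin g)).map (LinearEquiv.ofInjective M.mulVecLin hinj))
    rw [this, Module.Basis.det_apply]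
    congr 2
    ext i j
    rw [Module.Basis.toMatrix_apply, Module.Basis.map_apply, Pi.basisFun_apply, Pi.basisFun_repr,
      LinearEquiv.ofInjective_apply]
    simp
  have hle : M.mulVecLin.range.toAddSubgroup ≤ H.comap π := by
    rintro _ ⟨x, rfl⟩
    refine ⟨π x, ?_⟩
    ext i
    simp [π, Matrix.mulVec, dotProduct]
  rw [← hidx]
  refine Nat.le_of_dvd ?_ (AddSubgroup.index_dvd_of_le hle)
  rw [hidx]
  exact Int.natAbs_pos.2 hM

/-- The rational vector with the given integer coordinates. -/
def toRat {g : ℕ} (w : Fin g → ℤ) : Fin g → ℚ := fun j => (w j : ℚ)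

/-- Completing the given rows to a basis by unit vectors keeps the determinant small, since a unit
row contributes only a factor 1. -/
theorem exists_matrix_of_linearIndependent {g n L : ℕ} (w : Fin n → Fin g → ℤ)
    (hw : LinearIndependent ℚ fun i => toRat (w i)) (hL : ∀ i, ∑ j, (w i j).natAbs ≤ L) :
    ∃ (M : Matrix (Fin g) (Fin g) ℤ) (ι : Fin n → Fin g), Function.Injective ι ∧
      (∀ i, M (ι i) = w i) ∧ M.det ≠ 0 ∧ M.det.natAbs ≤ L ^ n := by
  classical
  let u : Fin n ⊕ Fin g → Fin g → ℤ := Sum.elim w fun j => Pi.single j 1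
  have hs : LinearIndepOn ℚ (fun i => toRat (u i)) (Set.range Sum.inl) :=
    (linearIndepOn_range_iff Sum.inl_injective _).2 hw
  obtain ⟨b, -, hsb, htb, hli⟩ := exists_linearIndepOn_extension hs (Set.subset_univ _)
  have hunit : ∀ j : Fin g, toRat (u (Sum.inr j)) = Pi.single j 1 := by
    intro j
    ext i
    rcases eq_or_ne i j with rfl | h
    · simp [u, toRat]
    · simp [u, toRat, h]
  have hspan : ⊤ ≤ Submodule.span ℚ (Set.range fun i : b => toRat (u i)) := by
    rw [← (Pi.basisFun ℚ (Fin g)).span_eq, Submodule.span_le]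
    rintro _ ⟨j, rfl⟩
    have := htb (Set.mem_image_of_mem (fun i => toRat (u i)) (Set.mem_univ (Sum.inr j)))
    rw [Set.image_eq_range] at this
    simpa [hunit] using this
  let B := Module.Basis.mk hli hspan
  have hcard : Fintype.card (Fin g) = Fintype.card b := by
    rw [← Module.finrank_eq_card_basis B, Module.finrank_fintype_fun_eq_card]
  let e : Fin g ≃ b := Fintype.equivOfCardEq hcard
  let M : Matrix (Fin g) (Fin g) ℤ := Matrix.of fun i => u (e i)
  let ι : Fin n → Fin g := fun i => e.symm ⟨Sum.inl i, hsb ⟨i, rfl⟩⟩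
  have hι : Function.Injective ι := by
    intro i j h
    simpa [ι] using h
  have hM : ∀ i, M (ι i) = w i := by
    intro i
    change u (e (e.symm _)) = _
    rw [e.apply_symm_apply]
    rfl
  refine ⟨M, ι, hι, hM, ?_, ?_⟩
  · have hrow : LinearIndependent ℚ (M.map (Int.cast : ℤ → ℚ)).row := hli.comp e e.injective
    rw [Matrix.linearIndependent_rows_iff_isUnit, Matrix.isUnit_iff_isUnit_det] at hrow
    intro h
    have : (M.map (Int.cast : ℤ → ℚ)).det = ((M.det : ℤ) : ℚ) :=
      ((Int.castRingHom ℚ).map_det M).symm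
    rw [this, h] at hrow
    simp at hrow
  · refine (natAbs_det_le_prod M).trans ?_
    calc ∏ i, ∑ j, (M i j).natAbs
        ≤ ∏ i, if i ∈ Finset.univ.image ι then L else 1 := by
          refine Finset.prod_le_prod' fun i _ => ?_
          split_ifs with h
          · obtain ⟨i', -, rfl⟩ := Finset.mem_image.1 h
            rw [hM]
            exact hL i'
          · rcases hx : (e i : Fin n ⊕ Fin g) with a | a
            · exact absurd (Finset.mem_image.2 ⟨a, Finset.mem_univ _, by
                rw [Equiv.symm_apply_eq]; exact Subtype.ext hx.symm⟩) h
            · have : M i = Pi.single a 1 := by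
                change u (e i) = _
                rw [hx]; rfl
              rw [this, Finset.sum_eq_single a] <;> simp +contextual
      _ = L ^ n := by
          rw [Finset.prod_ite_mem, Finset.univ_inter, Finset.prod_const,
            Finset.card_image_of_injective _ hι, Finset.card_univ, Fintype.card_fin]

/-- Reduction of an integer linear form modulo `N`, evaluated at `γ`. -/
def evalForm {g : ℕ} {Γ : Type*} [AddCommGroup Γ] (γ : Fin g → Γ) (w : Fin g → ℤ) : Γ :=
  ∑ j, w j • γ j

/-- The completed matrix sends solutions to vectors with `n` vanishing coordinates, and each of its
fibres is empty or a coset of a kernel of size at most `L ^ n`. -/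
theorem card_solutions_le {g n L N : ℕ} [NeZero N] (w : Fin n → Fin g → ℤ)
    (hw : LinearIndependent ℚ fun i => toRat (w i)) (hL : ∀ i, ∑ j, (w i j).natAbs ≤ L) :
    (Finset.univ.filter fun γ : Fin g → ZMod N => ∀ i, evalForm γ (w i) = 0).card ≤
      L ^ n * N ^ (g - n) := by
  classical
  obtain ⟨M, ι, hι, hM, hdet, hdetL⟩ := exists_matrix_of_linearIndependent w hw hL
  set f := (M.map (Int.cast : ℤ → ZMod N)).mulVecLin.toAddMonoidHom with hf
  have hfι : ∀ γ i, f γ (ι i) = evalForm γ (w i) := by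
    intro γ i
    simp [hf, Matrix.mulVec, dotProduct, evalForm, ← hM]
  have h1 := Finset.card_le_mul_card_image_of_maps_to
    (s := Finset.univ.filter fun γ : Fin g → ZMod N => ∀ i, evalForm γ (w i) = 0)
    (t := Finset.univ.filter fun y : Fin g → ZMod N => ∀ i, y (ι i) = 0) (f := f)
    (fun γ hγ => by
      simp only [Finset.mem_filter, Finset.mem_univ, true_and] at hγ ⊢
      exact fun i => (hfι γ i).trans (hγ i)) (L ^ n) (by
      intro y _
      refine le_trans ?_ ((card_ker_zmod_le (N := N) M hdet).trans hdetL)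
      rcases Finset.eq_empty_or_nonempty (Finset.filter (fun a => f a = y)
        (Finset.univ.filter fun γ : Fin g → ZMod N => ∀ i, evalForm γ (w i) = 0)) with h | ⟨a, ha⟩
      · rw [h]; simp
      rw [Nat.card_eq_fintype_card]
      refine Finset.card_le_card_of_injOn (s := _) (t := (Finset.univ.filter fun x => x ∈ f.ker))
        (fun x => x - a) ?_ ?_ |>.trans ?_
      · intro x hx
        simp only [Finset.coe_filter, Finset.mem_filter, Finset.mem_univ, true_and,
          Set.mem_ofPred_eq, AddMonoidHom.mem_ker, map_sub] at hx ha ⊢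
        rw [hx.2, ha.2, sub_self]
      · intro x _ x' _ h
        simpa using h
      · rw [Fintype.card_subtype])
  refine h1.trans (Nat.mul_le_mul_left _ ?_)
  have h2 := Finset.card_le_card_of_injOn (s := Finset.univ.filter fun y : Fin g → ZMod N =>
      ∀ i, y (ι i) = 0)
    (t := (Finset.univ : Finset ({j : Fin g // j ∉ Finset.univ.image ι} → ZMod N)))
    (fun y j => y j) (fun _ _ => Finset.mem_univ _) (by
      intro y hy y' hy' h
      simp only [Finset.coe_filter, Finset.mem_univ, true_and, Set.mem_ofPred_eq] at hy hy'
      ext j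
      by_cases hj : j ∈ Finset.univ.image ι
      · obtain ⟨i, -, rfl⟩ := Finset.mem_image.1 hj
        rw [hy, hy']
      · have := congrFun h ⟨j, hj⟩
        simp only at this
        rw [this])
  refine h2.trans (le_of_eq ?_)
  rw [Finset.card_univ, Fintype.card_fun, ZMod.card, Fintype.card_subtype_compl, Fintype.card_fin,
    Fintype.card_coe, Finset.card_image_of_injective _ hι, Finset.card_univ, Fintype.card_fin]

/-- The number of tuples satisfying linear relations from `W` of rank at least `n`. -/
theorem card_tuples_le {g n L N : ℕ} [NeZero N] (W : Finset (Fin g → ℤ))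
    (hL : ∀ w ∈ W, ∑ j, (w j).natAbs ≤ L) (S : Finset (Fin g → ZMod N))
    (hS : ∀ γ ∈ S, n ≤ Module.finrank ℚ
      (Submodule.span ℚ (toRat '' {w | w ∈ W ∧ evalForm γ w = 0}))) :
    S.card ≤ W.card ^ n * (L ^ n * N ^ (g - n)) := by
  classical
  have hsub : S ⊆ ((Fintype.piFinset fun _ : Fin n => W).filter fun w =>
      LinearIndependent ℚ fun i => toRat (w i)).biUnion fun w =>
      Finset.univ.filter fun γ : Fin g → ZMod N => ∀ i, evalForm γ (w i) = 0 := by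
    intro γ hγ
    obtain ⟨f, hf, -, hli⟩ := Submodule.exists_fun_fin_finrank_span_eq ℚ
      (toRat '' {w | w ∈ W ∧ evalForm γ w = 0})
    choose v hv hvf using hf
    simp only [Finset.mem_biUnion, Finset.mem_filter, Fintype.mem_piFinset, Finset.mem_univ,
      true_and]
    refine ⟨fun i => v (Fin.castLE (hS γ hγ) i), ⟨fun i => (hv _).1, ?_⟩, fun i => (hv _).2⟩
    simp only [hvf]
    exact hli.comp _ (Fin.castLE_injective _)
  refine (Finset.card_le_card hsub).trans ((Finset.card_biUnion_le_card_mul _ _ (L ^ n * N ^ (g - n)) ?_).trans ?_)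
  · intro w hw
    rw [Finset.mem_filter, Fintype.mem_piFinset] at hw
    exact card_solutions_le w hw.2 fun i => hL _ (hw.1 i)
  · refine Nat.mul_le_mul_right _ ((Finset.card_filter_le _ _).trans ?_)
    simp

/-! ### From additive coincidences to relations, and the bound (ii) -/

theorem evalForm_add {g : ℕ} {Γ : Type*} [AddCommGroup Γ] (γ : Fin g → Γ) (w w' : Fin g → ℤ) :
    evalForm γ (w + w') = evalForm γ w + evalForm γ w' := by
  simp [evalForm, add_smul, Finset.sum_add_distrib]

theorem evalForm_sub {g : ℕ} {Γ : Type*} [AddCommGroup Γ] (γ : Fin g → Γ) (w w' : Fin g → ℤ) :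
    evalForm γ (w - w') = evalForm γ w - evalForm γ w' := by
  simp [evalForm, sub_smul, Finset.sum_sub_distrib]

theorem evalForm_single {g : ℕ} {Γ : Type*} [AddCommGroup Γ] (γ : Fin g → Γ) (i : Fin g) :
    evalForm γ (Pi.single i 1) = γ i := by
  rw [evalForm, Finset.sum_eq_single i] <;> simp +contextual

theorem toRat_add {g : ℕ} (w w' : Fin g → ℤ) : toRat (w + w') = toRat w + toRat w' := by
  ext; simp [toRat]

theorem toRat_sub {g : ℕ} (w w' : Fin g → ℤ) : toRat (w - w') = toRat w - toRat w' := by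
  ext; simp [toRat]

theorem toRat_single {g : ℕ} (i : Fin g) : toRat (Pi.single i 1) = Pi.single i 1 := by
  ext j
  rcases eq_or_ne j i with rfl | h
  · simp [toRat]
  · simp [toRat, h]

/-- The rank inequality needs an order on the target; embedding into `ℝ` supplies one without losing
rank. -/
theorem exists_injective_rat_linearMap_real (V : Type) [AddCommGroup V] [Module ℚ V]
    [FiniteDimensional ℚ V] : ∃ f : V →ₗ[ℚ] ℝ, Function.Injective f := by
  rw [← rank_le_iff_exists_linearMap, Real.rank_rat_real]
  exact (Module.rank_lt_aleph0 ℚ V).le.trans Cardinal.aleph0_le_continuum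

/-- If the elements of `X` are integer combinations `c x` of `γ`, the additive quadruples of `X`
force many independent relations among the entries of `γ`. -/
theorem le_finrank_relations {g : ℕ} {Γ : Type*} [AddCommGroup Γ] [DecidableEq Γ] (γ : Fin g → Γ)
    (X : Finset Γ) (c : Γ → Fin g → ℤ) (hγX : ∀ i, γ i ∈ X) (hcγ : ∀ i, c (γ i) = Pi.single i 1)
    (hc : ∀ x ∈ X, evalForm γ (c x) = x) (W : Finset (Fin g → ℤ))
    (hW : ∀ a ∈ X, ∀ b ∈ X, ∀ d ∈ X, ∀ e ∈ X, a ≠ b → d ≠ e → c a + c b - (c d + c e) ∈ W)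
    (ρ : ℕ) (hρ : 2 * (restrictedSumset X).card < ρ * X.card) :
    g - ρ ≤ Module.finrank ℚ (Submodule.span ℚ (toRat '' {w | w ∈ W ∧ evalForm γ w = 0})) := by
  set U := Submodule.span ℚ (toRat '' {w | w ∈ W ∧ evalForm γ w = 0}) with hU
  obtain ⟨f, hf⟩ := exists_injective_rat_linearMap_real ((Fin g → ℚ) ⧸ U)
  let φ : Γ → ℝ := fun x => f (U.mkQ (toRat (c x)))
  have hφ := finrank_differenceSpan_mul_card_le φ X (by
    intro a ha b hb d hd e he hab hde h
    have hmem : toRat (c a + c b - (c d + c e)) ∈ U := by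
      refine Submodule.subset_span ⟨_, ⟨hW a ha b hb d hd e he hab hde, ?_⟩, rfl⟩
      rw [evalForm_sub, evalForm_add, evalForm_add, hc a ha, hc b hb, hc d hd, hc e he, h, sub_self]
    have h0 : f (U.mkQ (toRat (c a + c b - (c d + c e)))) = 0 := by
      rw [Submodule.mkQ_apply, (Submodule.Quotient.mk_eq_zero U).2 hmem, map_zero]
    simp only [toRat_sub, toRat_add, map_sub, map_add] at h0
    exact sub_eq_zero.1 h0)
  have hlt : Module.finrank ℚ (differenceSpan φ X) < ρ :=
    lt_of_mul_lt_mul_right (lt_of_le_of_lt hφ hρ) (Nat.zero_le _)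
  have hV : Module.finrank ℚ ((Fin g → ℚ) ⧸ U) + Module.finrank ℚ U = g := by
    simpa using Submodule.finrank_quotient_add_finrank U
  -- The quotient is spanned by the differences and one base vector, because the unit vectors occur
  -- among the coordinates. This is the loss of 1, absorbed by the strict inequality with `ρ`.
  suffices Module.finrank ℚ ((Fin g → ℚ) ⧸ U) ≤ Module.finrank ℚ (differenceSpan φ X) + 1 by omega
  rw [← LinearMap.finrank_range_of_inj hf]
  rcases Nat.eq_zero_or_pos g with rfl | hg
  · have := LinearMap.finrank_range_le f
    omega
  let i₀ : Fin g := ⟨0, hg⟩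
  have hle : f.range ≤ differenceSpan φ X ⊔ Submodule.span ℚ {φ (γ i₀)} := by
    have htop : (⊤ : Submodule ℚ (Fin g → ℚ)) = Submodule.span ℚ (Set.range (Pi.basisFun ℚ (Fin g))) :=
      (Pi.basisFun ℚ (Fin g)).span_eq.symm
    have : f.range = (f ∘ₗ U.mkQ).range := by
      rw [LinearMap.range_comp, Submodule.range_mkQ, Submodule.map_top]
    rw [this, LinearMap.range_eq_map, htop, Submodule.map_span, Submodule.span_le]
    rintro _ ⟨_, ⟨i, rfl⟩, rfl⟩
    have e : (f ∘ₗ U.mkQ) ((Pi.basisFun ℚ (Fin g)) i) = (φ (γ i) - φ (γ i₀)) + φ (γ i₀) := by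
      simp [φ, hcγ, toRat_single]
    rw [e]
    exact Submodule.add_mem_sup (Submodule.subset_span ⟨_, hγX i, _, hγX i₀, rfl⟩)
      (Submodule.mem_span_singleton_self _)
  refine (Submodule.finrank_mono hle).trans ((Submodule.finrank_add_le_finrank_add_finrank _ _).trans ?_)
  exact Nat.add_le_add_left ((finrank_span_le_card _).trans (by simp)) _

theorem card_restrictedFamily_le_pow (k N m : ℕ) [NeZero N] (hk : 1 ≤ k) :
    (restrictedFamily (ZMod N) k m).card ≤ k ^ (4 * k) * N ^ (1 + 2 * m / k) := by
  classical
  set ρ := 1 + 2 * m / k with hρ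
  let q : (Fin k × Fin k) × (Fin k × Fin k) → Fin k → ℤ := fun p =>
    Pi.single p.1.1 1 + Pi.single p.1.2 1 - (Pi.single p.2.1 1 + Pi.single p.2.2 1)
  -- Ordered pairs `i < j` suffice by commutativity. The resulting saving of 4 in `W.card` cancels
  -- the factor `L = 4` exactly.
  let P : Finset (Fin k × Fin k) := Finset.univ.filter fun p => p.1 < p.2
  let W : Finset (Fin k → ℤ) := (P ×ˢ P).image q
  have hq1 : ∀ p, ∑ j, (q p j).natAbs ≤ 4 := by
    intro p
    have h1 : ∀ i : Fin k, ∑ j, ((Pi.single i 1 : Fin k → ℤ) j).natAbs = 1 := by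
      intro i
      rw [Finset.sum_eq_single i] <;> simp +contextual
    calc ∑ j, (q p j).natAbs ≤ ∑ j, (((Pi.single p.1.1 1 : Fin k → ℤ) j).natAbs +
          ((Pi.single p.1.2 1 : Fin k → ℤ) j).natAbs + (((Pi.single p.2.1 1 : Fin k → ℤ) j).natAbs +
          ((Pi.single p.2.2 1 : Fin k → ℤ) j).natAbs)) := by
          refine Finset.sum_le_sum fun j _ => ?_
          simp only [q, Pi.sub_apply, Pi.add_apply]
          omega
      _ = 4 := by simp [Finset.sum_add_distrib, h1]
  have hP : 2 * P.card ≤ k ^ 2 := by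
    have h1 : P.card = (Finset.univ.filter fun p : Fin k × Fin k => p.2 < p.1).card :=
      Finset.card_bij (fun p _ => p.swap) (by simp [P]) (by simp) (fun p hp => ⟨p.swap, by
        simpa [P] using hp, by simp⟩)
    have h2 := Finset.card_le_univ (P ∪ Finset.univ.filter fun p : Fin k × Fin k => p.2 < p.1)
    rw [Finset.card_union_of_disjoint, ← h1] at h2
    · simp at h2; nlinarith
    · rw [Finset.disjoint_filter]
      intro p _ h h'
      exact lt_asymm h h'
  have hWcard : W.card * 4 ≤ k ^ 4 := by
    have : W.card ≤ P.card * P.card := Finset.card_image_le.trans (by rw [Finset.card_product])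
    nlinarith
  let S : Finset (Fin k → ZMod N) := Finset.univ.filter fun γ => k - ρ ≤ Module.finrank ℚ
      (Submodule.span ℚ (toRat '' {w | w ∈ W ∧ evalForm γ w = 0}))
  have hS := card_tuples_le (n := k - ρ) (L := 4) W (by
    intro w hw
    obtain ⟨p, -, rfl⟩ := Finset.mem_image.1 hw
    exact hq1 p) S (fun γ hγ => (Finset.mem_filter.1 hγ).2)
  have hfam : restrictedFamily (ZMod N) k m ⊆ S.image fun γ => Finset.univ.image γ := by
    intro X hX
    obtain ⟨hXk, hXm⟩ := (Finset.mem_filter.1 hX).2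
    let e : Fin k ≃ X := (Finset.equivFinOfCardEq hXk).symm
    let γ : Fin k → ZMod N := fun i => e i
    have hγ : Function.Injective γ := Subtype.val_injective.comp e.injective
    refine Finset.mem_image.2 ⟨γ, Finset.mem_filter.2 ⟨Finset.mem_univ _, ?_⟩, ?_⟩
    · have : Nonempty (Fin k) := ⟨⟨0, hk⟩⟩
      have hex : ∀ x ∈ X, ∃ i, γ i = x := fun x hx => ⟨e.symm ⟨x, hx⟩, by simp [γ]⟩
      let c : ZMod N → Fin k → ℤ := fun x => Pi.single (Function.invFun γ x) 1
      have hinv : ∀ i, Function.invFun γ (γ i) = i := Function.leftInverse_invFun hγ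
      have hsingle : ∀ a ∈ X, ∀ b ∈ X, a ≠ b → ∃ p ∈ P,
          c a + c b = Pi.single p.1 1 + Pi.single p.2 1 := by
        intro a ha b hb hab
        obtain ⟨i, rfl⟩ := hex a ha
        obtain ⟨j, rfl⟩ := hex b hb
        simp only [c, hinv]
        rcases lt_trichotomy i j with h | h | h
        · exact ⟨(i, j), by simpa [P] using h, rfl⟩
        · exact absurd (congrArg γ h) hab
        · exact ⟨(j, i), by simpa [P] using h, add_comm _ _⟩
      refine le_finrank_relations γ X c (fun i => (e i).2) (fun i => by simp only [c, hinv]) ?_ W ?_ ρ ?_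
      · intro x hx
        obtain ⟨i, rfl⟩ := hex x hx
        simp only [c, hinv, evalForm_single]
      · intro a ha b hb d hd e he hab hde
        obtain ⟨p, hp, h⟩ := hsingle a ha b hb hab
        obtain ⟨p', hp', h'⟩ := hsingle d hd e he hde
        rw [h, h']
        exact Finset.mem_image.2 ⟨(p, p'), Finset.mem_product.2 ⟨hp, hp'⟩, rfl⟩
      · rw [hXk, hXm, hρ, add_comm 1, mul_comm]
        exact (Nat.lt_mul_div_succ _ hk).trans_eq (by ring)
    · ext x
      simp only [Finset.mem_image, Finset.mem_univ, true_and]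
      exact ⟨by rintro ⟨i, rfl⟩; exact (e i).2, fun hx => ⟨e.symm ⟨x, hx⟩, by simp [γ]⟩⟩
  have hN : 1 ≤ N := NeZero.one_le
  calc (restrictedFamily (ZMod N) k m).card ≤ S.card :=
        (Finset.card_le_card hfam).trans Finset.card_image_le
    _ ≤ W.card ^ (k - ρ) * (4 ^ (k - ρ) * N ^ (k - (k - ρ))) := hS
    _ = (W.card * 4) ^ (k - ρ) * N ^ (k - (k - ρ)) := by rw [mul_pow, mul_assoc]
    _ ≤ (k ^ 4) ^ (k - ρ) * N ^ ρ :=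
        Nat.mul_le_mul (Nat.pow_le_pow_left hWcard _) (Nat.pow_le_pow_right hN tsub_tsub_le)
    _ ≤ (k ^ 4) ^ k * N ^ ρ :=
        Nat.mul_le_mul_right _ (Nat.pow_le_pow_right (Nat.pow_pos hk) (Nat.sub_le _ _))
    _ = _ := by rw [← pow_mul]

/-! ### Dissociated sets and short coordinates -/

section
open scoped Pointwise
variable {Γ : Type*} [AddCommGroup Γ] [DecidableEq Γ]

theorem sum_mem_card_nsmul (X G : Finset Γ) (h : G ⊆ X) : ∑ x ∈ G, x ∈ G.card • X := by
  induction G using Finset.induction_on with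
  | empty => simp
  | insert a s ha ih =>
    rw [Finset.sum_insert ha, Finset.card_insert_of_notMem ha, succ_nsmul, add_comm a]
    exact Finset.add_mem_add (ih fun x hx => h (Finset.mem_insert_of_mem hx))
      (h (Finset.mem_insert_self _ _))

/-- A set all of whose subset sums are distinct. -/
def Dissociated (G : Finset Γ) : Prop :=
  ∀ A ⊆ G, ∀ B ⊆ G, ∑ x ∈ A, x = ∑ x ∈ B, x → A = B

theorem Dissociated.choose_card_le {G X : Finset Γ} (hG : Dissociated G) (hGX : G ⊆ X) (j : ℕ) :
    G.card.choose j ≤ (j • X).card := by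
  rw [← Finset.card_powersetCard]
  refine Finset.card_le_card_of_injOn (fun A => ∑ x ∈ A, x) ?_ ?_
  · intro A hA
    obtain ⟨hAG, hAj⟩ := Finset.mem_powersetCard.1 hA
    rw [← hAj]
    exact sum_mem_card_nsmul X A (hAG.trans hGX)
  · intro A hA B hB h
    exact hG A (Finset.mem_powersetCard.1 hA).1 B (Finset.mem_powersetCard.1 hB).1 h

/-- For a maximal dissociated `G`, adjoining `x` creates a coincidence of subset sums.
Dissociativity of `G` forces `x` to occur on exactly one side, so the coincidence can be solved for
`x`. -/
theorem exists_dissociated_spanning (X : Finset Γ) :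
    ∃ G ⊆ X, Dissociated G ∧ ∀ x ∈ X, ∃ A ⊆ G, ∃ B ⊆ G, x = ∑ y ∈ B, y - ∑ y ∈ A, y := by
  classical
  obtain ⟨G, hG, hmax⟩ := (X.powerset.filter Dissociated).exists_max_image Finset.card
    ⟨∅, by simp [Dissociated]⟩
  rw [Finset.mem_filter, Finset.mem_powerset] at hG
  refine ⟨G, hG.1, hG.2, fun x hx => ?_⟩
  by_cases hxG : x ∈ G
  · exact ⟨∅, by simp, {x}, by simpa using hxG, by simp⟩
  have hnd : ¬ Dissociated (insert x G) := by
    intro h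
    have := hmax _ (Finset.mem_filter.2 ⟨Finset.mem_powerset.2 (Finset.insert_subset hx hG.1), h⟩)
    rw [Finset.card_insert_of_notMem hxG] at this
    omega
  unfold Dissociated at hnd
  push Not at hnd
  obtain ⟨A, hA, B, hB, hAB, hne⟩ := hnd
  have herase : ∀ A ⊆ insert x G, A.erase x ⊆ G := fun A hA => Finset.subset_insert_iff.1 hA
  have hsub : ∀ A ⊆ insert x G, x ∉ A → A ⊆ G := fun A hA h =>
    (Finset.subset_insert_iff_of_notMem h).1 hA
  by_cases h1 : x ∈ A <;> by_cases h2 : x ∈ B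
  · exfalso
    rw [← Finset.add_sum_erase A _ h1, ← Finset.add_sum_erase B _ h2, add_right_inj] at hAB
    have := hG.2 _ (herase A hA) _ (herase B hB) hAB
    exact hne (by rw [← Finset.insert_erase h1, this, Finset.insert_erase h2])
  · refine ⟨_, herase A hA, _, hsub B hB h2, ?_⟩
    rw [← hAB, ← Finset.add_sum_erase A _ h1, add_sub_cancel_right]
  · refine ⟨_, herase B hB, _, hsub A hA h1, ?_⟩
    rw [hAB, ← Finset.add_sum_erase B _ h2, add_sub_cancel_right]
  · exact absurd (hG.2 _ (hsub A hA h1) _ (hsub B hB h2) hAB) hne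

/-- If `jX` is small, then `X` lies in the `{-1, 0, 1}`-span of `g` of its elements. -/
theorem exists_coordinates (X : Finset Γ) (g j : ℕ) (hgX : g ≤ X.card)
    (hj : (j • X).card < g.choose j) :
    ∃ (γ : Fin g → Γ) (c : Γ → Fin g → ℤ), (∀ i, γ i ∈ X) ∧ (∀ i, c (γ i) = Pi.single i 1) ∧
      (∀ x ∈ X, evalForm γ (c x) = x) ∧ ∀ x ∈ X, ∀ i, c x i ∈ Finset.Icc (-1 : ℤ) 1 := by
  classical
  obtain ⟨G₀, hG₀X, hdis, hspan⟩ := exists_dissociated_spanning X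
  have hG₀ : G₀.card ≤ g := by
    by_contra h
    exact absurd ((Nat.choose_le_choose j (not_le.1 h).le).trans (hdis.choose_card_le hG₀X j))
      (not_le.2 hj)
  obtain ⟨G, hG₀G, hGX, hGg⟩ := Finset.exists_subsuperset_card_eq hG₀X hG₀ hgX
  let e : Fin g ≃ G := (Finset.equivFinOfCardEq hGg).symm
  let γ : Fin g → Γ := fun i => e i
  have hγ : Function.Injective γ := Subtype.val_injective.comp e.injective
  have hex : ∀ x ∈ G, ∃ i, γ i = x := fun x hx => ⟨e.symm ⟨x, hx⟩, by simp [γ]⟩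
  have hind : ∀ A ⊆ G, evalForm γ (fun i => if γ i ∈ A then 1 else 0) = ∑ x ∈ A, x := by
    intro A hA
    simp only [evalForm, ite_smul, one_smul, zero_smul]
    rw [← Finset.sum_filter]
    refine Finset.sum_bij (fun i _ => γ i) ?_ ?_ ?_ ?_
    · intro i hi; exact (Finset.mem_filter.1 hi).2
    · intro i _ i' _ h; exact hγ h
    · intro x hx
      obtain ⟨i, rfl⟩ := hex x (hA hx)
      exact ⟨i, Finset.mem_filter.2 ⟨Finset.mem_univ _, hx⟩, rfl⟩
    · intro i _; rfl
  choose! A hA B hB hAB using hspan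
  -- Elements of `G` get unit vectors, including those added only to reach size `g`; this makes `c
  -- (γ i)` the `i`-th unit vector.
  refine ⟨γ, fun x i => if x ∈ G then (if γ i = x then 1 else 0) else
    (if γ i ∈ B x then 1 else 0) - (if γ i ∈ A x then 1 else 0), fun i => hGX (e i).2, ?_, ?_, ?_⟩
  · intro i
    have hi : γ i ∈ G := (e i).2
    ext i'
    simp only [hi, if_true, hγ.eq_iff, Pi.single_apply]
  · intro x hx
    by_cases hxG : x ∈ G
    · simp only [hxG, if_true]
      have := hind {x} (by simpa using hxG)
      simpa using this
    · simp only [hxG, if_false]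
      have := evalForm_sub γ (fun i => if γ i ∈ B x then 1 else 0)
        (fun i => if γ i ∈ A x then 1 else 0)
      rw [hind _ ((hB x hx).trans hG₀G), hind _ ((hA x hx).trans hG₀G), ← hAB x hx] at this
      exact this
  · intro x _ i
    rw [Finset.mem_Icc]
    dsimp only
    split_ifs <;> norm_num
end

/-! ### Hitting sets and sparse covers -/

section
variable {α ι : Type*} [DecidableEq α]

/-- Greedy choice: by double counting some point lies in at least a fraction `d / X.card` of the
sets not yet hit. -/
theorem exists_partial_hitting_set (X : Finset α) (S : Finset ι) (F : ι → Finset α) (d ℓ : ℕ)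
    (hF : ∀ i ∈ S, F i ⊆ X ∧ d ≤ (F i).card) :
    ∃ H ⊆ X, H.card ≤ ℓ ∧
      (S.filter fun i => Disjoint (F i) H).card * X.card ^ ℓ ≤ S.card * (X.card - d) ^ ℓ := by
  classical
  induction ℓ with
  | zero => exact ⟨∅, by simp⟩
  | succ ℓ ih =>
    obtain ⟨H, hHX, hHc, hH⟩ := ih
    rcases X.eq_empty_or_nonempty with rfl | hX
    · exact ⟨∅, by simp⟩
    set T := S.filter fun i => Disjoint (F i) H with hT
    have hsum : ∑ x ∈ X, (T.filter fun i => x ∈ F i).card = ∑ i ∈ T, (F i).card := by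
      have := Finset.sum_card_bipartiteAbove_eq_sum_card_bipartiteBelow (s := X) (t := T)
        (fun x i => x ∈ F i)
      simp only [Finset.bipartiteAbove, Finset.bipartiteBelow] at this
      rw [this]
      refine Finset.sum_congr rfl fun i hi => ?_
      rw [Finset.filter_mem_eq_inter, Finset.inter_eq_right.2 (hF i (Finset.mem_filter.1 hi).1).1]
    obtain ⟨x, hx, hmax⟩ := X.exists_max_image (fun x => (T.filter fun i => x ∈ F i).card) hX
    have h1 : T.card * d ≤ X.card * (T.filter fun i => x ∈ F i).card := by
      calc T.card * d ≤ ∑ i ∈ T, (F i).card := by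
            rw [← smul_eq_mul]
            exact Finset.card_nsmul_le_sum _ _ _ fun i hi => (hF i (Finset.mem_filter.1 hi).1).2
        _ ≤ X.card * _ := by
            rw [← hsum, ← smul_eq_mul]
            exact Finset.sum_le_card_nsmul _ _ _ hmax
    refine ⟨insert x H, Finset.insert_subset hx hHX, (Finset.card_insert_le _ _).trans (by omega), ?_⟩
    have h2 : (S.filter fun i => Disjoint (F i) (insert x H)) = T.filter fun i => x ∉ F i := by
      ext i
      simp only [hT, Finset.mem_filter, Finset.disjoint_insert_right]
      tauto
    have h3 := Finset.card_filter_add_card_filter_not (s := T) (fun i => x ∈ F i)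
    rw [h2]
    have h4 : (T.filter fun i => x ∉ F i).card * X.card ≤ T.card * (X.card - d) := by
      rw [Nat.mul_sub]
      have : (T.filter fun i => x ∉ F i).card * X.card + T.card * d ≤ T.card * X.card := by
        rw [← h3]; nlinarith
      omega
    calc (T.filter fun i => x ∉ F i).card * X.card ^ (ℓ + 1)
        = ((T.filter fun i => x ∉ F i).card * X.card) * X.card ^ ℓ := by ring
      _ ≤ (T.card * (X.card - d)) * X.card ^ ℓ := Nat.mul_le_mul_right _ h4
      _ = (T.card * X.card ^ ℓ) * (X.card - d) := by ring
      _ ≤ (S.card * (X.card - d) ^ ℓ) * (X.card - d) := Nat.mul_le_mul_right _ hH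
      _ = _ := by ring

/-- After `ℓ` greedy steps the number of missed sets is at most `S.card * exp (-d * ℓ / X.card) <
1`. -/
theorem exists_hitting_set (X : Finset α) (S : Finset ι) (F : ι → Finset α) (d ℓ : ℕ)
    (hF : ∀ i ∈ S, F i ⊆ X ∧ d ≤ (F i).card)
    (hS : (S.card : ℝ) < Real.exp (d * ℓ / X.card)) :
    ∃ H ⊆ X, H.card ≤ ℓ ∧ ∀ i ∈ S, ¬ Disjoint (F i) H := by
  obtain ⟨H, hHX, hHc, hH⟩ := exists_partial_hitting_set X S F d ℓ hF
  refine ⟨H, hHX, hHc, fun i hi hdis => ?_⟩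
  have hT : 1 ≤ (S.filter fun i => Disjoint (F i) H).card :=
    Finset.card_pos.2 ⟨i, Finset.mem_filter.2 ⟨hi, hdis⟩⟩
  have hdk : d ≤ X.card := (hF i hi).2.trans (Finset.card_le_card (hF i hi).1)
  have h1 : X.card ^ ℓ ≤ S.card * (X.card - d) ^ ℓ := (Nat.le_mul_of_pos_left _ hT).trans hH
  rcases Nat.eq_zero_or_pos X.card with hk | hk
  · rw [hk] at hS
    simp only [Nat.cast_zero, div_zero, Real.exp_zero] at hS
    have : 1 ≤ S.card := Finset.card_pos.2 ⟨i, hi⟩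
    exact absurd hS (not_lt.2 (by exact_mod_cast this))
  have hk' : (0 : ℝ) < X.card := by exact_mod_cast hk
  have h2 : (X.card : ℝ) ^ ℓ ≤ S.card * (X.card - d : ℝ) ^ ℓ := by
    rw [← Nat.cast_sub hdk]; exact_mod_cast h1
  have h3 : (X.card - d : ℝ) ≤ X.card * Real.exp (-(d / X.card)) := by
    calc (X.card - d : ℝ) = X.card * (1 - d / X.card) := by field_simp
      _ ≤ _ := mul_le_mul_of_nonneg_left (Real.one_sub_le_exp_neg _) hk'.le
  have h0 : (0 : ℝ) ≤ X.card - d := by rw [sub_nonneg]; exact_mod_cast hdk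
  have h4 : (X.card - d : ℝ) ^ ℓ ≤ X.card ^ ℓ * (Real.exp (d * ℓ / X.card))⁻¹ := by
    refine (pow_le_pow_left₀ h0 h3 ℓ).trans_eq ?_
    rw [mul_pow, ← Real.exp_nat_mul, ← Real.exp_neg]
    congr 2; ring
  have hpos : (0 : ℝ) < X.card ^ ℓ := pow_pos hk' _
  have h5 : (X.card : ℝ) ^ ℓ ≤ S.card * (X.card ^ ℓ * (Real.exp (d * ℓ / X.card))⁻¹) :=
    h2.trans (mul_le_mul_of_nonneg_left h4 (Nat.cast_nonneg _))
  have h6 : (S.card : ℝ) * (X.card ^ ℓ * (Real.exp (d * ℓ / X.card))⁻¹) < X.card ^ ℓ := by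
    rw [← mul_assoc, mul_inv_lt_iff₀ (Real.exp_pos _), mul_comm]
    exact mul_lt_mul_of_pos_left hS hpos
  linarith

/-- Apply single hitting `u` times, each time deleting the points already chosen; the reserve `u *
ℓ` keeps at least `d` points in every set. -/
theorem exists_multiple_hitting_set (X : Finset α) (S : Finset ι) (F : ι → Finset α) (d ℓ u : ℕ)
    (hF : ∀ i ∈ S, F i ⊆ X ∧ d + u * ℓ ≤ (F i).card)
    (hS : (S.card : ℝ) < Real.exp (d * ℓ / X.card)) :
    ∃ H ⊆ X, H.card ≤ u * ℓ ∧ ∀ i ∈ S, u ≤ (F i ∩ H).card := by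
  induction u with
  | zero => exact ⟨∅, by simp⟩
  | succ u ih =>
    obtain ⟨H, hHX, hHc, hH⟩ := ih fun i hi => ⟨(hF i hi).1, by have := (hF i hi).2; nlinarith⟩
    obtain ⟨H', hHX', hHc', hH'⟩ := exists_hitting_set X S (fun i => F i \ H) d ℓ (by
      intro i hi
      refine ⟨Finset.sdiff_subset.trans (hF i hi).1, ?_⟩
      have h1 := Finset.le_card_sdiff H (F i)
      have h2 := (hF i hi).2
      have h3 : (u + 1) * ℓ = u * ℓ + ℓ := by ring
      omega) hS
    refine ⟨H ∪ H', Finset.union_subset hHX hHX', ?_, fun i hi => ?_⟩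
    · refine (Finset.card_union_le _ _).trans ?_
      rw [add_mul, one_mul]; omega
    · have hne : ((F i \ H) ∩ H').Nonempty := Finset.not_disjoint_iff_nonempty_inter.1 (hH' i hi)
      have hsub : (F i ∩ H) ∪ ((F i \ H) ∩ H') ⊆ F i ∩ (H ∪ H') := by
        intro x hx
        simp only [Finset.mem_union, Finset.mem_inter, Finset.mem_sdiff] at hx ⊢
        tauto
      have hdis : Disjoint (F i ∩ H) ((F i \ H) ∩ H') := by
        rw [Finset.disjoint_left]
        intro x hx hx'
        simp only [Finset.mem_inter, Finset.mem_sdiff] at hx hx'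
        tauto
      have h1 := Finset.card_le_card hsub
      rw [Finset.card_union_of_disjoint hdis] at h1
      have h2 := hH i hi
      have h3 := hne.card_pos
      omega
end

section
variable {Γ : Type*} [AddCommGroup Γ] [DecidableEq Γ]

/-- Up to a small exceptional set `E`, a translate of `X` lies in the restricted sumset of two
small subsets `A` and `B` of `X`. -/
theorem exists_sparse_cover (X : Finset Γ) (hX : X.Nonempty) (d ℓ u b : ℕ)
    (h1 : ((restrictedSumset X).card : ℝ) < Real.exp (d * ℓ / X.card))
    (h2 : ((restrictedSumset X).card : ℝ) < Real.exp (u * b / X.card)) :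
    ∃ x₀ ∈ X, ∃ A ⊆ X, ∃ B ⊆ X, ∃ E ⊆ X, A.card ≤ u * ℓ ∧ B.card ≤ b ∧
      E.card ≤ (restrictedSumset X).card * (d + u * ℓ) / X.card + 1 ∧
      ∀ x ∈ X, x ∈ E ∨ ∃ a ∈ A, ∃ b ∈ B, a ≠ b ∧ a + b - x₀ = x := by
  classical
  set R := restrictedSumset X with hR
  let F : Γ → Finset Γ := fun s => X.filter fun a => s - a ∈ X ∧ a ≠ s - a
  -- `P` consists of the popular sums. `A` meets the summands of each popular sum in at least `u`
  -- points, and `B` then hits their complementary summands, so every popular sum is `a + b` with `a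
  -- ∈ A`, `b ∈ B`.
  let P := R.filter fun s => d + u * ℓ ≤ (F s).card
  have hPR : (P.card : ℝ) ≤ R.card := by exact_mod_cast Finset.card_filter_le _ _
  obtain ⟨A, hAX, hAc, hA⟩ := exists_multiple_hitting_set X P F d ℓ u
    (fun s hs => ⟨Finset.filter_subset _ _, (Finset.mem_filter.1 hs).2⟩) (hPR.trans_lt h1)
  obtain ⟨B, hBX, hBc, hB⟩ := exists_hitting_set X P (fun s => (F s ∩ A).image fun a => s - a) u b
    (by
      intro s hs
      constructor
      · intro y hy
        obtain ⟨a, ha, rfl⟩ := Finset.mem_image.1 hy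
        exact (Finset.mem_filter.1 (Finset.mem_inter.1 ha).1).2.1
      · rw [Finset.card_image_of_injective _ (sub_right_injective)]
        exact hA s hs) (hPR.trans_lt h2)
  -- count the pairs with unpopular sum
  let T : Γ → Finset Γ := fun x => X.filter fun y => x ≠ y ∧ x + y ∉ P
  obtain ⟨x₀, hx₀, hmin⟩ := X.exists_min_image (fun x => (T x).card) hX
  have hcount : X.card * (T x₀).card ≤ R.card * (d + u * ℓ) := by
    calc X.card * (T x₀).card ≤ ∑ x ∈ X, (T x).card := by
          rw [← smul_eq_mul]
          exact Finset.card_nsmul_le_sum _ _ _ hmin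
      _ = (X.sigma T).card := (Finset.card_sigma _ _).symm
      _ ≤ ((R \ P).sigma F).card := by
          refine Finset.card_le_card_of_injOn (fun p => ⟨p.1 + p.2, p.1⟩) ?_ ?_
          · rintro ⟨x, y⟩ hp
            simp only [Finset.coe_sigma, Set.mem_sigma_iff, Finset.mem_coe, T, F, Finset.mem_filter,
              Finset.mem_sdiff, add_sub_cancel_left] at hp ⊢
            exact ⟨⟨mem_restrictedSumset.2 ⟨x, hp.1, y, hp.2.1, hp.2.2.1, rfl⟩, hp.2.2.2⟩,
              hp.1, hp.2.1, hp.2.2.1⟩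
          · rintro ⟨x, y⟩ _ ⟨x', y'⟩ _ h
            simp only [Sigma.mk.injEq, heq_eq_eq] at h
            obtain ⟨h, rfl⟩ := h
            simpa using h
      _ = ∑ s ∈ R \ P, (F s).card := Finset.card_sigma _ _
      _ ≤ (R \ P).card * (d + u * ℓ) := by
          rw [← smul_eq_mul]
          refine Finset.sum_le_card_nsmul _ _ _ fun s hs => ?_
          rw [Finset.mem_sdiff] at hs
          by_contra h
          exact hs.2 (Finset.mem_filter.2 ⟨hs.1, (not_le.1 h).le⟩)
      _ ≤ _ := Nat.mul_le_mul_right _ (Finset.card_le_card Finset.sdiff_subset)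
  -- By averaging, `x₀` has few partners with unpopular sum. It joins `E` itself because `x₀ + x₀`
  -- is not a restricted sum of this pair.
  refine ⟨x₀, hx₀, A, hAX, B, hBX, insert x₀ (T x₀), Finset.insert_subset hx₀
    (Finset.filter_subset _ _), hAc, hBc, ?_, ?_⟩
  · refine (Finset.card_insert_le _ _).trans (Nat.add_le_add_right ?_ 1)
    rw [Nat.le_div_iff_mul_le hX.card_pos, mul_comm]
    exact hcount
  · intro x hx
    by_cases hxT : x = x₀ ∨ x ∈ T x₀
    · exact Or.inl (Finset.mem_insert.2 hxT)
    right
    have hP : x₀ + x ∈ P := by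
      by_contra h
      exact hxT (by
        by_cases hxx : x = x₀
        · exact Or.inl hxx
        · exact Or.inr (Finset.mem_filter.2 ⟨hx, fun h => hxx h.symm, h⟩))
    obtain ⟨y, hy, hyB⟩ := Finset.not_disjoint_iff.1 (hB _ hP)
    obtain ⟨a, ha, rfl⟩ := Finset.mem_image.1 hy
    rw [Finset.mem_inter] at ha
    exact ⟨a, ha.2, _, hyB, (Finset.mem_filter.1 ha.1).2.2, by abel⟩
end

/-! ### Containers and the general counting bound -/

theorem exists_fin_covering {α : Type*} {X A : Finset α} {t : ℕ} (hX : X.Nonempty) (hA : A ⊆ X)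
    (ht : A.card ≤ t) : ∃ f : Fin t → α, (∀ i, f i ∈ X) ∧ ∀ a ∈ A, ∃ i, f i = a := by
  obtain ⟨x₀, hx₀⟩ := hX
  refine ⟨fun i => if h : (i : ℕ) < A.card then A.equivFin.symm ⟨i, h⟩ else x₀, fun i => ?_,
    fun a ha => ?_⟩
  · dsimp only
    split_ifs with h
    · exact hA (A.equivFin.symm ⟨i, h⟩).2
    · exact hx₀
  · refine ⟨Fin.castLE ht (A.equivFin ⟨a, ha⟩), ?_⟩
    simp

/-- The container determined by a tuple `γ` and coordinate vectors with respect to it. -/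
def container {g t : ℕ} {Γ : Type*} [AddCommGroup Γ] [DecidableEq Γ] (γ : Fin g → Γ)
    (τ : (Fin t → Fin g → ℤ) × (Fin t → Fin g → ℤ) × (Fin t → Fin g → ℤ) × (Fin g → ℤ)) :
    Finset Γ :=
  ((Finset.univ.filter fun p : Fin t × Fin t => evalForm γ (τ.1 p.1) ≠ evalForm γ (τ.2.1 p.2)).image
    fun p => evalForm γ (τ.1 p.1) + evalForm γ (τ.2.1 p.2) - evalForm γ τ.2.2.2) ∪
  Finset.univ.image fun i => evalForm γ (τ.2.2.1 i)

open scoped Pointwise in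
theorem card_add_self_le {Γ : Type*} [AddCommGroup Γ] [DecidableEq Γ] (X : Finset Γ) :
    (X + X).card ≤ (restrictedSumset X).card + X.card := by
  have : X + X ⊆ restrictedSumset X ∪ X.image fun x => x + x := by
    intro z hz
    obtain ⟨x, hx, y, hy, rfl⟩ := Finset.mem_add.1 hz
    rw [Finset.mem_union]
    by_cases h : x = y
    · subst h; exact Or.inr (Finset.mem_image_of_mem _ hx)
    · exact Or.inl (mem_restrictedSumset.2 ⟨x, hx, y, hy, h, rfl⟩)
  exact (Finset.card_le_card this).trans ((Finset.card_union_le _ _).trans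
    (Nat.add_le_add_left Finset.card_image_le _))

-- Plünnecke–Ruzsa, with the doubling bounded through `X + X`, which exceeds the restricted sumset
-- by at most the doubles `x + x`.
open scoped Pointwise in
theorem card_nsmul_lt_choose {Γ : Type*} [AddCommGroup Γ] [DecidableEq Γ] (X : Finset Γ)
    (hX : X.Nonempty) (g j : ℕ)
    (h : ((((restrictedSumset X).card + X.card : ℕ) : ℝ) / X.card) ^ j * X.card < g.choose j) :
    (j • X).card < g.choose j := by
  have h1 := Finset.pluennecke_ruzsa_inequality_nsmul_add hX X j
  have h2 : (((j • X).card : ℚ≥0) : ℝ) ≤ (((((X + X).card : ℚ≥0) / X.card) ^ j * X.card : ℚ≥0) : ℝ) := by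
    exact_mod_cast h1
  push_cast at h2
  have h3 : (((X + X).card : ℝ) / X.card) ^ j * X.card ≤
      ((((restrictedSumset X).card + X.card : ℕ) : ℝ) / X.card) ^ j * X.card := by
    have : ((X + X).card : ℝ) ≤ ((restrictedSumset X).card + X.card : ℕ) := by
      exact_mod_cast card_add_self_le X
    gcongr
  exact_mod_cast (h2.trans h3).trans_lt h

/-- The factors count, in turn, the choices of relations, their determinant loss, the free part of
`γ`, the coordinates of the three covering lists and of `x₀`, and the `k`-subsets of a container. -/
theorem card_restrictedFamily_le_choose {k N m g j d ℓ u b t : ℕ} [NeZero N] (hk : 1 ≤ k)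
    (hgk : g ≤ k) (hj : (((m + k : ℕ) : ℝ) / k) ^ j * k < g.choose j)
    (h1 : (m : ℝ) < Real.exp (d * ℓ / k)) (h2 : (m : ℝ) < Real.exp (u * b / k))
    (ht1 : u * ℓ ≤ t) (ht2 : b ≤ t) (ht3 : m * (d + u * ℓ) / k + 1 ≤ t) (htm : t ≤ m) :
    (restrictedFamily (ZMod N) k m).card ≤
      (9 ^ g) ^ g * (4 * g + 1) ^ g * N ^ (1 + 2 * m / k) * 3 ^ (g * (3 * t + 1)) *
        (2 * m).choose k := by
  classical
  set ρ := 1 + 2 * m / k with hρ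
  let W : Finset (Fin g → ℤ) := Fintype.piFinset fun _ => Finset.Icc (-4 : ℤ) 4
  let C : Finset (Fin g → ℤ) := Fintype.piFinset fun _ => Finset.Icc (-1 : ℤ) 1
  have hWcard : W.card = 9 ^ g := by simp [W]
  have hCcard : C.card = 3 ^ g := by simp [C]
  let S : Finset (Fin g → ZMod N) := Finset.univ.filter fun γ => g - ρ ≤ Module.finrank ℚ
      (Submodule.span ℚ (toRat '' {w | w ∈ W ∧ evalForm γ w = 0}))
  -- The weight is at most `4 * g`; the extra 1 keeps the base positive when `g = 0`, so that the
  -- exponent can be enlarged to `g`.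
  have hS := card_tuples_le (n := g - ρ) (L := 4 * g + 1) W (by
    intro w hw
    have : ∀ j ∈ (Finset.univ : Finset (Fin g)), (w j).natAbs ≤ 4 := by
      intro j _
      have := Finset.mem_Icc.1 (Fintype.mem_piFinset.1 hw j)
      omega
    have := Finset.sum_le_card_nsmul _ _ _ this
    simp only [Finset.card_univ, Fintype.card_fin, smul_eq_mul] at this
    omega) S (fun γ hγ => (Finset.mem_filter.1 hγ).2)
  let T := (Fintype.piFinset fun _ : Fin t => C) ×ˢ (Fintype.piFinset fun _ : Fin t => C) ×ˢ
    (Fintype.piFinset fun _ : Fin t => C) ×ˢ C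
  have hTcard : T.card = 3 ^ (g * (3 * t + 1)) := by
    simp only [T, Finset.card_product, Fintype.card_piFinset, hCcard, Finset.prod_const,
      Finset.card_univ, Fintype.card_fin]
    ring
  have hfam : restrictedFamily (ZMod N) k m ⊆
      ((S ×ˢ T).filter fun p => (container p.1 p.2).card ≤ 2 * m).biUnion fun p =>
        (container p.1 p.2).powersetCard k := by
    intro X hX
    obtain ⟨hXk, hXm⟩ := (Finset.mem_filter.1 hX).2
    have hXne : X.Nonempty := Finset.card_pos.1 (by omega)
    obtain ⟨γ, c, hγX, hcγ, hc, hc1⟩ := exists_coordinates X g j (hgk.trans_eq hXk.symm)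
      (card_nsmul_lt_choose X hXne g j (by rw [hXk, hXm]; exact hj))
    obtain ⟨x₀, hx₀, A, hA, B, hB, E, hE, hAc, hBc, hEc, hcov⟩ := exists_sparse_cover X hXne d ℓ u b
      (by rw [hXk, hXm]; exact h1) (by rw [hXk, hXm]; exact h2)
    rw [hXk, hXm] at hEc
    obtain ⟨α, hαX, hα⟩ := exists_fin_covering hXne hA (hAc.trans ht1)
    obtain ⟨β, hβX, hβ⟩ := exists_fin_covering hXne hB (hBc.trans ht2)
    obtain ⟨η, hηX, hη⟩ := exists_fin_covering hXne hE (hEc.trans ht3)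
    have hcC : ∀ x ∈ X, c x ∈ C := fun x hx => Fintype.mem_piFinset.2 (hc1 x hx)
    let τ : (Fin t → Fin g → ℤ) × (Fin t → Fin g → ℤ) × (Fin t → Fin g → ℤ) × (Fin g → ℤ) :=
      (fun i => c (α i), fun i => c (β i), fun i => c (η i), c x₀)
    have hα' : ∀ i, evalForm γ (c (α i)) = α i := fun i => hc _ (hαX i)
    have hβ' : ∀ i, evalForm γ (c (β i)) = β i := fun i => hc _ (hβX i)
    have hη' : ∀ i, evalForm γ (c (η i)) = η i := fun i => hc _ (hηX i)
    have hx₀' : evalForm γ (c x₀) = x₀ := hc _ hx₀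
    refine Finset.mem_biUnion.2 ⟨(γ, τ), Finset.mem_filter.2 ⟨Finset.mem_product.2 ⟨?_, ?_⟩, ?_⟩, ?_⟩
    · refine Finset.mem_filter.2 ⟨Finset.mem_univ _, ?_⟩
      refine le_finrank_relations γ X c hγX hcγ hc W ?_ ρ ?_
      · intro a ha b hb d hd e he _ _
        refine Fintype.mem_piFinset.2 fun i => ?_
        have ha := Finset.mem_Icc.1 (hc1 a ha i)
        have hb := Finset.mem_Icc.1 (hc1 b hb i)
        have hd := Finset.mem_Icc.1 (hc1 d hd i)
        have he := Finset.mem_Icc.1 (hc1 e he i)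
        simp only [Pi.sub_apply, Pi.add_apply, Finset.mem_Icc]
        omega
      · rw [hXk, hXm, hρ, add_comm 1, mul_comm]
        exact (Nat.lt_mul_div_succ _ hk).trans_eq (by ring)
    · simp only [T, τ, Finset.mem_product, Fintype.mem_piFinset]
      exact ⟨fun i => hcC _ (hαX i),
        fun i => hcC _ (hβX i),
        fun i => hcC _ (hηX i), hcC _ hx₀⟩
    · have hsub : container γ τ ⊆ ((restrictedSumset X).image fun s => s - x₀) ∪
          Finset.univ.image η := by
        simp only [container, τ, hα', hβ', hη', hx₀']
        refine Finset.union_subset_union_left ?_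
        intro z hz
        obtain ⟨⟨i, i'⟩, hp, rfl⟩ := Finset.mem_image.1 hz
        exact Finset.mem_image_of_mem _ (mem_restrictedSumset.2
          ⟨α i, hαX i, β i', hβX i', (Finset.mem_filter.1 hp).2, rfl⟩)
      refine (Finset.card_le_card hsub).trans ((Finset.card_union_le _ _).trans ?_)
      have e1 : ((restrictedSumset X).image fun s => s - x₀).card ≤ m :=
        Finset.card_image_le.trans_eq hXm
      have e2 : (Finset.univ.image η).card ≤ t := Finset.card_image_le.trans_eq (by simp)
      omega
    · refine Finset.mem_powersetCard.2 ⟨fun x hx => ?_, hXk⟩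
      simp only [container, τ, hα', hβ', hη', hx₀']
      rcases hcov x hx with h | ⟨a, ha, b, hb, hab, h⟩
      · obtain ⟨i, hi⟩ := hη x h
        exact Finset.mem_union_right _ (Finset.mem_image.2 ⟨i, Finset.mem_univ _, hi⟩)
      · obtain ⟨i, rfl⟩ := hα a ha
        obtain ⟨i', rfl⟩ := hβ b hb
        exact Finset.mem_union_left _ (Finset.mem_image.2
          ⟨(i, i'), Finset.mem_filter.2 ⟨Finset.mem_univ _, hab⟩, h⟩)
  have hN : 1 ≤ N := NeZero.one_le
  calc (restrictedFamily (ZMod N) k m).card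
      ≤ ((S ×ˢ T).filter fun p => (container p.1 p.2).card ≤ 2 * m).card * (2 * m).choose k := by
        refine (Finset.card_le_card hfam).trans (Finset.card_biUnion_le_card_mul _ _ _ ?_)
        intro p hp
        rw [Finset.card_powersetCard]
        exact Nat.choose_le_choose _ (Finset.mem_filter.1 hp).2
    _ ≤ (S.card * T.card) * (2 * m).choose k :=
        Nat.mul_le_mul_right _ ((Finset.card_filter_le _ _).trans_eq (Finset.card_product _ _))
    _ ≤ ((9 ^ g) ^ g * (4 * g + 1) ^ g * N ^ ρ * 3 ^ (g * (3 * t + 1))) * (2 * m).choose k := by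
        refine Nat.mul_le_mul_right _ (Nat.mul_le_mul (hS.trans ?_) hTcard.le)
        rw [hWcard, ← mul_assoc]
        refine Nat.mul_le_mul (Nat.mul_le_mul (Nat.pow_le_pow_right (by positivity) (Nat.sub_le _ _))
          (Nat.pow_le_pow_right (by omega) (Nat.sub_le _ _)))
          (Nat.pow_le_pow_right hN tsub_tsub_le)

/-! ### Choice of parameters and asymptotics -/

theorem card_le_card_restrictedSumset_add_one {Γ : Type*} [AddCommGroup Γ] [DecidableEq Γ]
    (X : Finset Γ) : X.card ≤ (restrictedSumset X).card + 1 := by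
  rcases X.eq_empty_or_nonempty with rfl | ⟨x, hx⟩
  · simp
  rw [← Finset.card_erase_add_one hx, ← Finset.card_image_of_injective (X.erase x) (add_right_injective x)]
  refine Nat.add_le_add_right (Finset.card_le_card fun z hz => ?_) 1
  obtain ⟨y, hy, rfl⟩ := Finset.mem_image.1 hz
  rw [Finset.mem_erase] at hy
  exact mem_restrictedSumset.2 ⟨x, hx, y, hy.2, Ne.symm hy.1, rfl⟩

theorem natPow_div_le_rpow {k N m : ℕ} [NeZero N] :
    (N : ℝ) ^ (1 + 2 * m / k) ≤ (N : ℝ) ^ (1 + 4 * (m : ℝ) / (k : ℝ)) := by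
  have hN : (1 : ℝ) ≤ N := by exact_mod_cast (NeZero.one_le : 1 ≤ N)
  rw [← Real.rpow_natCast]
  refine Real.rpow_le_rpow_of_exponent_le hN ?_
  push_cast
  have h1 : ((2 * m / k : ℕ) : ℝ) ≤ ((2 * m : ℕ) : ℝ) / k := Nat.cast_div_le
  have h2 : ((2 * m : ℕ) : ℝ) / k ≤ 4 * (m : ℝ) / k := by
    push_cast
    have : (0 : ℝ) ≤ m := Nat.cast_nonneg m
    gcongr
    norm_num
  linarith

/-- Uses `k! ≥ (k / e) ^ k`, a single term of the exponential series. -/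
theorem choose_le_exp_mul_pow {m k : ℕ} (hk : 1 ≤ k) :
    (((2 * m).choose k : ℕ) : ℝ) ≤ (2 * Real.exp 1 * (m : ℝ) / k) ^ k := by
  have h1 : (((2 * m).choose k : ℕ) : ℝ) ≤ ((2 * m : ℕ) : ℝ) ^ k / (k.factorial : ℝ) :=
    Nat.choose_le_pow_div k (2 * m)
  have h2 : (k : ℝ) ^ k / (k.factorial : ℝ) ≤ Real.exp k :=
    Real.pow_div_factorial_le_exp (k : ℝ) (Nat.cast_nonneg k) k
  have hk' : (0 : ℝ) < k := by exact_mod_cast hk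
  have h3 : (1 : ℝ) / k.factorial ≤ Real.exp 1 ^ k / (k : ℝ) ^ k := by
    rw [le_div_iff₀ (pow_pos hk' k), ← Real.exp_nat_mul, mul_one]
    calc 1 / (k.factorial : ℝ) * (k : ℝ) ^ k = (k : ℝ) ^ k / (k.factorial : ℝ) := by ring
      _ ≤ _ := h2
  calc _ ≤ _ := h1
    _ = ((2 * m : ℕ) : ℝ) ^ k * (1 / (k.factorial : ℝ)) := by ring
    _ ≤ ((2 * m : ℕ) : ℝ) ^ k * (Real.exp 1 ^ k / (k : ℝ) ^ k) := by gcongr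
    _ = _ := by
      rw [← mul_div_assoc, ← mul_pow, ← div_pow]
      push_cast
      congr 2; ring

theorem error_factor_le_exp (g t : ℕ) :
    ((9 : ℝ) ^ g) ^ g * (4 * g + 1) ^ g * 3 ^ (g * (3 * t + 1)) ≤
      Real.exp (7 * g ^ 2 + 6 * (g * t) + 2 * g) := by
  have h3 : (3 : ℝ) ≤ Real.exp 2 := by linarith [Real.add_one_le_exp (2 : ℝ)]
  have h9 : (9 : ℝ) ≤ Real.exp 3 := by
    have h2 : (2.7 : ℝ) ≤ Real.exp 1 := by linarith [Real.exp_one_gt_d9]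
    calc (9 : ℝ) ≤ 2.7 ^ 3 := by norm_num
      _ ≤ Real.exp 1 ^ 3 := by gcongr
      _ = Real.exp 3 := by rw [← Real.exp_nat_mul]; norm_num
  have h4 : (4 * g + 1 : ℝ) ≤ Real.exp (4 * g) := Real.add_one_le_exp _
  calc ((9 : ℝ) ^ g) ^ g * (4 * g + 1) ^ g * 3 ^ (g * (3 * t + 1))
      ≤ (Real.exp 3 ^ g) ^ g * Real.exp (4 * g) ^ g * Real.exp 2 ^ (g * (3 * t + 1)) := by gcongr
    _ = _ := by
      simp only [← Real.exp_nat_mul, ← Real.exp_add]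
      push_cast
      ring_nf

theorem lt_choose_eight {g : ℕ} {y : ℝ} (hy : 1000 ≤ y) (hg : y ^ 10 ≤ g) :
    y ^ 76 < (g.choose 8 : ℝ) := by
  have h1 : (((g + 1 - 8 : ℕ) : ℝ) ^ 8) / (Nat.factorial 8 : ℝ) ≤ (g.choose 8 : ℝ) :=
    Nat.pow_le_choose 8 g
  have hy0 : 0 < y := by linarith
  have h10 : (1000 : ℝ) ≤ y ^ 10 := hy.trans (le_self_pow₀ (by linarith) (by norm_num))
  have hg8 : 8 ≤ g + 1 := by
    have : (1000 : ℝ) ≤ g := h10.trans hg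
    have : 1000 ≤ g := by exact_mod_cast this
    omega
  have h2 : y ^ 10 / 2 ≤ ((g + 1 - 8 : ℕ) : ℝ) := by
    rw [Nat.cast_sub hg8]; push_cast; linarith
  refine lt_of_lt_of_le ?_ h1
  calc y ^ 76 < (y ^ 10 / 2) ^ 8 / (Nat.factorial 8 : ℝ) := by
        rw [lt_div_iff₀ (by positivity)]
        have h4 : (1000 : ℝ) ^ 4 ≤ y ^ 4 := by gcongr
        have h5 : (Nat.factorial 8 : ℝ) = 40320 := by norm_num [Nat.factorial]
        rw [h5, div_pow, ← pow_mul, show y ^ (10 * 8) = y ^ 76 * y ^ 4 by ring, mul_div_assoc]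
        exact mul_lt_mul_of_pos_left (by linarith) (by positivity)
    _ ≤ _ := by gcongr

theorem card_restrictedFamily_le_of_large {k N m : ℕ} [NeZero N] {y : ℝ} (hy : 1000 ≤ y)
    (hyexp : y ^ 62 < Real.exp y) (hyk : y ^ 60 = k) (hm : (m : ℝ) ≤ y ^ 62 / 2) :
    ((restrictedFamily (ZMod N) k m).card : ℝ) ≤
      (N : ℝ) ^ (1 + 4 * (m : ℝ) / (k : ℝ)) * (2 * Real.exp 1 * (m : ℝ) / (k : ℝ)) ^ k *
        Real.exp (y ^ 58) := by
  have hy0 : 0 < y := by linarith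
  have hk0 : (0 : ℝ) < k := by rw [← hyk]; positivity
  have hk : 1 ≤ k := by exact_mod_cast hk0
  rcases Finset.eq_empty_or_nonempty (restrictedFamily (ZMod N) k m) with h | ⟨X, hX⟩
  · rw [h, Finset.card_empty, Nat.cast_zero]; positivity
  have hkm : k ≤ m + 1 := by
    obtain ⟨hXk, hXm⟩ := (Finset.mem_filter.1 hX).2
    rw [← hXk, ← hXm]
    exact card_le_card_restrictedSumset_add_one X
  have hceil : ∀ n : ℕ, y ^ n ≤ (⌈y ^ n⌉₊ : ℝ) := fun n => Nat.le_ceil _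
  have hceil1 : ∀ n : ℕ, (⌈y ^ n⌉₊ : ℝ) ≤ y ^ n + 1 := fun n =>
    (Nat.ceil_lt_add_one (by positivity)).le
  have hone : ∀ n : ℕ, 1 ≤ y ^ n := fun n => one_le_pow₀ (by linarith)
  have hceil2 : ∀ n : ℕ, (⌈y ^ n⌉₊ : ℝ) ≤ 2 * y ^ n := fun n => by
    linarith [hceil1 n, hone n]
  -- absorb constants into powers of `y`
  have hstep : ∀ n n' : ℕ, n < n' → 1000 * y ^ n ≤ y ^ n' := fun n n' h => by
    calc 1000 * y ^ n ≤ y * y ^ n := by gcongr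
      _ = y ^ (n + 1) := by ring
      _ ≤ y ^ n' := pow_le_pow_right₀ (by linarith) h
  have hexp : ∀ p q : ℕ, y * k ≤ y ^ p * y ^ q →
      (m : ℝ) < Real.exp ((⌈y ^ p⌉₊ : ℝ) * (⌈y ^ q⌉₊ : ℝ) / k) := fun p q h => by
    have h1 : (m : ℝ) < Real.exp y := by
      have : 0 < y ^ 62 := by positivity
      linarith
    refine h1.trans_le (Real.exp_le_exp.2 ?_)
    rw [le_div_iff₀ hk0]
    exact h.trans (mul_le_mul (hceil p) (hceil q) (by positivity) (by positivity))
  have hul : (⌈y ^ 18⌉₊ : ℝ) * (⌈y ^ 21⌉₊ : ℝ) ≤ 4 * y ^ 39 :=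
    (mul_le_mul (hceil2 18) (hceil2 21) (by positivity) (by positivity)).trans_eq (by ring)
  -- With `k = y ^ 60` and `m / k ≤ y ^ 2 / 2`, both hitting exponents are at least `y` (`40 + 21 =
  -- 18 + 43 = 61`), and `m < exp y`. The exceptional set has order `y ^ 42`, below `t`; Plünnecke
  -- needs `y ^ 76` against `g.choose 8` of order `y ^ 80`. The dominant error exponent is `g * t`,
  -- of order `y ^ 55`.
  have hmain := card_restrictedFamily_le_choose (N := N) (k := k) (m := m) (g := ⌈y ^ 10⌉₊) (j := 8)
    (d := ⌈y ^ 40⌉₊) (ℓ := ⌈y ^ 21⌉₊) (u := ⌈y ^ 18⌉₊) (b := ⌈y ^ 43⌉₊) (t := ⌈y ^ 45⌉₊) hk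
    (by
      rw [Nat.ceil_le, ← hyk]
      exact pow_le_pow_right₀ (by linarith) (by norm_num))
    (by
      refine lt_of_le_of_lt ?_ (lt_choose_eight hy (hceil 10))
      have h1 : (((m + k : ℕ) : ℝ) / k) ≤ y ^ 2 := by
        rw [div_le_iff₀ hk0, ← hyk]
        push_cast
        rw [← hyk, show y ^ 2 * y ^ 60 = y ^ 62 by ring]
        linarith [hstep 60 62 (by norm_num), hone 62, show 0 < y ^ 60 by positivity]
      calc (((m + k : ℕ) : ℝ) / k) ^ 8 * k ≤ (y ^ 2) ^ 8 * k := by gcongr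
        _ = y ^ 76 := by rw [← hyk]; ring)
    (hexp 40 21 (by rw [← hyk]; exact le_of_eq (by ring)))
    (hexp 18 43 (by rw [← hyk]; exact le_of_eq (by ring)))
    (by
      have : (⌈y ^ 18⌉₊ : ℝ) * (⌈y ^ 21⌉₊ : ℝ) ≤ (⌈y ^ 45⌉₊ : ℝ) := by
        linarith [hceil 45, hstep 39 45 (by norm_num), hone 39]
      exact_mod_cast this)
    (Nat.ceil_le_ceil (pow_le_pow_right₀ (by linarith) (by norm_num)))
    (by
      have h1 : ((m * (⌈y ^ 40⌉₊ + ⌈y ^ 18⌉₊ * ⌈y ^ 21⌉₊) / k : ℕ) : ℝ) ≤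
          ((m * (⌈y ^ 40⌉₊ + ⌈y ^ 18⌉₊ * ⌈y ^ 21⌉₊) : ℕ) : ℝ) / k := Nat.cast_div_le
      have h2 : ((m * (⌈y ^ 40⌉₊ + ⌈y ^ 18⌉₊ * ⌈y ^ 21⌉₊) : ℕ) : ℝ) / k ≤ 6 * y ^ 42 := by
        rw [div_le_iff₀ hk0, ← hyk]
        push_cast
        have h3 : (⌈y ^ 40⌉₊ : ℝ) + (⌈y ^ 18⌉₊ : ℝ) * (⌈y ^ 21⌉₊ : ℝ) ≤ 6 * y ^ 40 := by
          linarith [hceil2 40, hstep 39 40 (by norm_num), hone 40, hone 39]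
        calc (m : ℝ) * ((⌈y ^ 40⌉₊ : ℝ) + (⌈y ^ 18⌉₊ : ℝ) * (⌈y ^ 21⌉₊ : ℝ))
            ≤ y ^ 62 * (6 * y ^ 40) := by
              refine mul_le_mul ?_ h3 (by positivity) (by positivity)
              linarith [hone 62]
          _ = _ := by ring
      have h3 : ((m * (⌈y ^ 40⌉₊ + ⌈y ^ 18⌉₊ * ⌈y ^ 21⌉₊) / k + 1 : ℕ) : ℝ) ≤ (⌈y ^ 45⌉₊ : ℝ) := by
        rw [Nat.cast_add, Nat.cast_one]
        linarith [hceil 45, hstep 42 45 (by norm_num), hone 42]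
      exact_mod_cast h3)
    (by
      have : (⌈y ^ 45⌉₊ : ℝ) + 1 ≤ (m + 1 : ℕ) := by
        refine le_trans ?_ (Nat.cast_le.2 hkm)
        rw [← hyk]
        linarith [hceil2 45, hstep 45 60 (by norm_num), hone 45]
      have : ⌈y ^ 45⌉₊ + 1 ≤ m + 1 := by exact_mod_cast this
      omega)
  have herr : ((9 : ℝ) ^ ⌈y ^ 10⌉₊) ^ ⌈y ^ 10⌉₊ * (4 * (⌈y ^ 10⌉₊ : ℝ) + 1) ^ ⌈y ^ 10⌉₊ *
      3 ^ (⌈y ^ 10⌉₊ * (3 * ⌈y ^ 45⌉₊ + 1)) ≤ Real.exp (y ^ 58) := by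
    refine (error_factor_le_exp _ _).trans (Real.exp_le_exp.2 ?_)
    have e1 : (⌈y ^ 10⌉₊ : ℝ) ^ 2 ≤ 4 * y ^ 20 := by
      calc (⌈y ^ 10⌉₊ : ℝ) ^ 2 ≤ (2 * y ^ 10) ^ 2 := by gcongr; exact hceil2 10
        _ = _ := by ring
    have e2 : (⌈y ^ 10⌉₊ : ℝ) * (⌈y ^ 45⌉₊ : ℝ) ≤ 4 * y ^ 55 :=
      (mul_le_mul (hceil2 10) (hceil2 45) (by positivity) (by positivity)).trans_eq (by ring)
    linarith [hceil2 10, hstep 10 20 (by norm_num), hstep 20 55 (by norm_num),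
      hstep 55 58 (by norm_num), hone 10, hone 20, hone 55]
  have hmain' := (Nat.cast_le (α := ℝ)).2 hmain
  push_cast at hmain'
  refine hmain'.trans ?_
  calc _ = (((9 : ℝ) ^ ⌈y ^ 10⌉₊) ^ ⌈y ^ 10⌉₊ * (4 * (⌈y ^ 10⌉₊ : ℝ) + 1) ^ ⌈y ^ 10⌉₊ *
      3 ^ (⌈y ^ 10⌉₊ * (3 * ⌈y ^ 45⌉₊ + 1))) * ((N : ℝ) ^ (1 + 2 * m / k) *
        (((2 * m).choose k : ℕ) : ℝ)) := by ring
    _ ≤ Real.exp (y ^ 58) * ((N : ℝ) ^ (1 + 4 * (m : ℝ) / (k : ℝ)) *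
        (2 * Real.exp 1 * (m : ℝ) / k) ^ k) := by
      gcongr
      · exact natPow_div_le_rpow
      · exact choose_le_exp_mul_pow hk
    _ = _ := by ring

theorem proposition23 :
    (∃ k₀ : ℕ, ∀ k : ℕ, k₀ ≤ k → ∀ (N : ℕ) [NeZero N] (m : ℕ),
      (m : ℝ) ≤ (k : ℝ) ^ ((31 : ℝ) / 30) / 2 →
      ((restrictedFamily (ZMod N) k m).card : ℝ) ≤
        (N : ℝ) ^ (1 + 4 * (m : ℝ) / (k : ℝ)) * (2 * Real.exp 1 * (m : ℝ) / (k : ℝ)) ^ k *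
          Real.exp ((k : ℝ) ^ ((31 : ℝ) / 32))) ∧
    (∀ k : ℕ, 1 ≤ k → ∀ (N : ℕ) [NeZero N] (m : ℕ),
      ((restrictedFamily (ZMod N) k m).card : ℝ) ≤
        (N : ℝ) ^ (1 + 4 * (m : ℝ) / (k : ℝ)) * (k : ℝ) ^ (4 * k)) := by
  constructor
  · have hexp : ∀ᶠ y : ℝ in Filter.atTop, y ^ 62 < Real.exp y := by
      have := (Real.tendsto_exp_div_pow_atTop 62).eventually_gt_atTop 1
      filter_upwards [this, Filter.eventually_gt_atTop 0] with y h hy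
      rwa [lt_div_iff₀ (by positivity), one_mul] at h
    have hroot : Filter.Tendsto (fun k : ℕ => (k : ℝ) ^ ((1 : ℝ) / 60)) Filter.atTop Filter.atTop :=
      (tendsto_rpow_atTop (by norm_num)).comp tendsto_natCast_atTop_atTop
    obtain ⟨k₀, hk₀⟩ := Filter.eventually_atTop.1
      (hroot.eventually (hexp.and (Filter.eventually_ge_atTop 1000)))
    refine ⟨max k₀ 1, fun k hk N _ m hm => ?_⟩
    obtain ⟨h1, h2⟩ := hk₀ k ((le_max_left _ _).trans hk)
    have hk1 : (1 : ℝ) ≤ k := by exact_mod_cast (le_max_right _ _).trans hk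
    have hpow : ∀ n : ℕ, ((k : ℝ) ^ ((1 : ℝ) / 60)) ^ n = (k : ℝ) ^ ((n : ℝ) / 60) := by
      intro n
      rw [← Real.rpow_mul_natCast (Nat.cast_nonneg k)]
      congr 1; ring
    refine (card_restrictedFamily_le_of_large h2 h1 ?_ ?_).trans ?_
    · rw [hpow]; norm_num
    · rw [hpow]
      norm_num at hm ⊢
      exact hm
    -- The error is `exp (k ^ (58 / 60))`, and `58 / 60 < 31 / 32`.
    · refine mul_le_mul_of_nonneg_left (Real.exp_le_exp.2 ?_) (by positivity)
      rw [hpow]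
      exact Real.rpow_le_rpow_of_exponent_le hk1 (by norm_num)
  · intro k hk N _ m
    have h := (Nat.cast_le (α := ℝ)).2 (card_restrictedFamily_le_pow k N m hk)
    push_cast at h
    refine h.trans ?_
    rw [mul_comm]
    exact mul_le_mul_of_nonneg_right natPow_div_le_rpow (by positivity)
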